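/- Let $\Gamma$ be a compact metric graph with finitely many vertices and finitely many edges $e_j$ (loops and multiple edges are allowed) of arbitrary lengths $l_j>0$, and on each edge let $a_j$ (damping) and $b_j$ (potential) be real, bounded, measurable functions on $[0,l_j]$. Let $H$ be the operator $H(\psi_1,\psi_2)=(\psi_2,\ \psi_1''+b\,\psi_1-2a\,\psi_2)$, acting edgewise, where $a=a_j$ and $b=b_j$ on $e_j$. Its domain consists of the pairs $(\psi_1,\psi_2)$ such that both $\psi_1$ and $\psi_2$ are of class $W^{2,2}$ on every edge and satisfy standard coupling at every vertex: the values at all edge ends meeting at the vertex are equal, and the sum of the outward derivatives over these edge ends is zero. A real number $c_0$ is called a high frequency abscissa of $H$ if there is a sequence $(\lambda_n)$ of eigenvalues of $H$ with $\lim_{n\to\infty}\operatorname{Im}\lambda_n=+\infty$ or $\lim_{n\to\infty}\operatorname{Im}\lambda_n=-\infty$, and $\lim_{n\to\infty}\operatorname{Re}\lambda_n=c_0$. **Theorem.** Suppose that $\Gamma$ contains a closed loop of $N\ge 1$ pairwise distinct edges, each of length one, and that for some $a\in\mathbb{R}$ the average $\int_0^1 a_j(x)\,dx$ of the damping function over every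 edge of the loop equals $a$. Then $-a$ is a high frequency abscissa of $H$. -/

import Mathlib

open MeasureTheory Set Filter Topology

noncomputable section

/-- A compact metric graph with vertex set `V` and edge set `E` (both finite wherever this is used;
loops and multiple edges are allowed). The edge `e` is the interval `[0, len e]`, with the endpoint
`0` glued to `src e` and the endpoint `len e` glued to `tgt e`; on it there are a damping function
and a potential, real and (essentially) bounded. -/
structure DampedGraph (V E : Type*) where
  src : E → V
  tgt : E → V
  len : E → ℝ
  len_pos : ∀ e, 0 < len e
  damping : E → ℝ → ℝ
  potential : E → ℝ → ℝ
  damping_bdd : ∀ e, MemLp (damping e) ⊤ (volume.restrict (Icc 0 (len e)))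
  potential_bdd : ∀ e, MemLp (potential e) ⊤ (volume.restrict (Icc 0 (len e)))

/-- The first derivative of `u` on the closed interval `[0, l]` (one-sided at the endpoints). -/
def edgeDeriv (l : ℝ) (u : ℝ → ℂ) : ℝ → ℂ := derivWithin u (Icc 0 l)

/-- The second derivative of `u` on `[0, l]`; it is only used almost everywhere. -/
def edgeDeriv₂ (l : ℝ) (u : ℝ → ℂ) : ℝ → ℂ := deriv (edgeDeriv l u)

/-- `u` is (the continuous representative of) an element of `W^{2,2}(0, l)`: it is differentiable
on `[0, l]`, its derivative is absolutely continuous on `[0, l]`, and its second derivative, which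
exists almost everywhere, is square integrable. -/
structure IsW22 (l : ℝ) (u : ℝ → ℂ) : Prop where
  differentiableOn : DifferentiableOn ℝ u (Icc 0 l)
  absolutelyContinuous : AbsolutelyContinuousOnInterval (edgeDeriv l u) 0 l
  memLp : MemLp (edgeDeriv₂ l u) 2 (volume.restrict (Icc 0 l))

namespace DampedGraph

variable {V E : Type*}

/-- The average of the damping function over the edge `e`. -/
def avgDamping (Γ : DampedGraph V E) (e : E) : ℝ :=
  (∫ x in (0 : ℝ)..Γ.len e, Γ.damping e x) / Γ.len e

/-- The sum over all edge ends at the vertex `v` of the outward derivatives (pointing from `v` into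
the edge) of `u`. An edge with both ends at `v` contributes both of its ends. -/
def outwardDerivSum [Fintype E] (Γ : DampedGraph V E) (u : E → ℝ → ℂ) (v : V) : ℂ :=
  open Classical in
  ∑ e, ((if Γ.src e = v then edgeDeriv (Γ.len e) (u e) 0 else 0) +
    (if Γ.tgt e = v then -edgeDeriv (Γ.len e) (u e) (Γ.len e) else 0))

/-- Standard (Kirchhoff) coupling at every vertex: the values of `u` at all edge ends at a vertex
are equal, and the outward derivatives at each vertex add up to zero. -/
def StandardCoupling [Fintype E] (Γ : DampedGraph V E) (u : E → ℝ → ℂ) : Prop :=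
  (∃ φ : V → ℂ, ∀ e, u e 0 = φ (Γ.src e) ∧ u e (Γ.len e) = φ (Γ.tgt e)) ∧
    ∀ v, Γ.outwardDerivSum u v = 0

/-- The domain of the operator `H` of the graph with standard coupling: both components of `ψ` are
of class `W^{2,2}` on every edge and satisfy the coupling conditions at the vertices. -/
def domain [Fintype E] (Γ : DampedGraph V E) : Set ((E → ℝ → ℂ) × (E → ℝ → ℂ)) :=
  {ψ | (∀ e, IsW22 (Γ.len e) (ψ.1 e) ∧ IsW22 (Γ.len e) (ψ.2 e)) ∧
    Γ.StandardCoupling ψ.1 ∧ Γ.StandardCoupling ψ.2}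

/-- The operator `H (ψ₁, ψ₂) = (ψ₂, ψ₁'' + b ψ₁ - 2 a ψ₂)`, with `a` the damping and `b` the
potential. -/
def H (Γ : DampedGraph V E) (ψ : (E → ℝ → ℂ) × (E → ℝ → ℂ)) :
    (E → ℝ → ℂ) × (E → ℝ → ℂ) :=
  (ψ.2, fun e x => edgeDeriv₂ (Γ.len e) (ψ.1 e) x + (Γ.potential e x : ℂ) * ψ.1 e x
    - 2 * (Γ.damping e x : ℂ) * ψ.2 e x)

/-- `z` is an eigenvalue of `H`: there is a nonzero `ψ` in the domain with `H ψ = z ψ` (almost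
everywhere on each edge). As elements of the domain are continuous on the closed edges, being
nonzero at one point is the same as being nonzero in `L²`. -/
def IsEigenvalue [Fintype E] (Γ : DampedGraph V E) (z : ℂ) : Prop :=
  ∃ ψ ∈ Γ.domain,
    (∃ e, ∃ x ∈ Icc 0 (Γ.len e), ψ.1 e x ≠ 0 ∨ ψ.2 e x ≠ 0) ∧
    ∀ e, ∀ᵐ x ∂(volume.restrict (Icc 0 (Γ.len e))),
      (Γ.H ψ).1 e x = z * ψ.1 e x ∧ (Γ.H ψ).2 e x = z * ψ.2 e x

/-- `c` is a high frequency abscissa of `H`: there is a sequence of eigenvalues whose imaginary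
parts tend to `+∞` or to `-∞` and whose real parts tend to `c`. -/
def IsHighFrequencyAbscissa [Fintype E] (Γ : DampedGraph V E) (c : ℝ) : Prop :=
  ∃ z : ℕ → ℂ, (∀ n, Γ.IsEigenvalue (z n)) ∧
    (Tendsto (fun n => (z n).im) atTop atTop ∨ Tendsto (fun n => (z n).im) atTop atBot) ∧
    Tendsto (fun n => (z n).re) atTop (𝓝 c)

/-- The `N` edges `e 0, …, e (N - 1)`, traversed successively (each in either direction) through the
vertices `v 0, …, v N = v 0`, form a closed loop: they are pairwise distinct and consecutive ones
share the corresponding vertex. -/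
structure IsLoop (Γ : DampedGraph V E) {N : ℕ} (v : Fin (N + 1) → V) (e : Fin N → E) : Prop where
  pos : 1 ≤ N
  closed : v (Fin.last N) = v 0
  injective : Function.Injective e
  joins : ∀ i : Fin N,
    (Γ.src (e i) = v i.castSucc ∧ Γ.tgt (e i) = v i.succ) ∨
      (Γ.src (e i) = v i.succ ∧ Γ.tgt (e i) = v i.castSucc)

end DampedGraph

end

noncomputable section

/-! For an eigenvalue z the first component solves u'' = (z² + 2za - b)u on every edge. For large
|z| with bounded real part, solutions behave like combinations of exp(±(zx + ∫a)), so for z = μ +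
2πin the transfer matrix of (u, u'/z) over an edge of length l is close to a hyperbolic rotation by
zl + ∫a. By recurrence on a torus, n can run through a sequence with exp(2πinl) → 1 on all edges at
once. The shift then drops out, and the limit is the hyperbolic rotation by μl + ∫a
(`tendsto_edgeSolution`).

Nonzero zeros of a secular determinant, holomorphic off z = 0, are eigenvalues
(`isEigenvalue_of_secularDet_eq_zero`). Its limit is an entire function of μ. At μ = -a the limit
matrix of every loop edge is the identity, so derivative data ±1 circulating round the loop, with
zero vertex values, satisfy all coupling conditions and the limit vanishes
(`IsLoop.secularDet_eq_zero`). It is not identically zero, by an energy flux argument at large real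
μ (`secularDet_hyperbolicMatrix_ne_zero`). Hurwitz's theorem then gives eigenvalues -a + o(1) +
2πin.

As a and b are merely bounded and measurable, the asymptotics come from variation of constants: the
amplitudes of the two exponentials are coupled through a rapidly oscillating factor, which the
Riemann–Lebesgue lemma and Grönwall's inequality control (`tendsto_deviation`). -/

theorem intervalIntegrable_of_measurable_of_norm_le {f : ℝ → ℂ} (hf : Measurable f) {C : ℝ}
    (hC : ∀ t, ‖f t‖ ≤ C) (x y : ℝ) : IntervalIntegrable f volume x y :=
  (intervalIntegrable_const (c := C)).mono_fun hf.aestronglyMeasurable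
    (Eventually.of_forall fun t => (hC t).trans (le_abs_self C))

theorem norm_integral_sub_le {f : ℝ → ℂ} (hf : Measurable f) {C : ℝ} (hC : ∀ t, ‖f t‖ ≤ C)
    (c x y : ℝ) : ‖(∫ t in c..x, f t) - ∫ t in c..y, f t‖ ≤ C * |x - y| := by
  rw [intervalIntegral.integral_interval_sub_left
    (intervalIntegrable_of_measurable_of_norm_le hf hC _ _)
    (intervalIntegrable_of_measurable_of_norm_le hf hC _ _)]
  exact intervalIntegral.norm_integral_le_of_norm_le_const fun t _ => hC t

theorem lipschitzWith_integral {f : ℝ → ℂ} (hf : Measurable f) {C : ℝ} (hC : ∀ t, ‖f t‖ ≤ C)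
    (c : ℝ) : LipschitzWith C.toNNReal fun x => ∫ t in c..x, f t := by
  have h0 : 0 ≤ C := (norm_nonneg _).trans (hC 0)
  refine LipschitzWith.of_dist_le_mul fun x y => ?_
  rw [dist_eq_norm, Real.coe_toNNReal C h0, Real.dist_eq]
  exact norm_integral_sub_le hf hC c x y

theorem norm_mul_projIcc_le {l : ℝ} (hl : 0 ≤ l) {q : ℝ → ℂ} {C : ℝ} (hC : ∀ t, ‖q t‖ ≤ C)
    (f : C(Icc 0 l, ℂ)) (t : ℝ) :
    ‖q t * f (projIcc 0 l hl t)‖ ≤ C * ‖f‖ := by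
  rw [norm_mul]
  exact mul_le_mul (hC t) (f.norm_coe_le_norm _) (norm_nonneg _) ((norm_nonneg _).trans (hC t))

theorem measurable_mul_projIcc {l : ℝ} (hl : 0 ≤ l) {q : ℝ → ℂ} (hq : Measurable q)
    (f : C(Icc 0 l, ℂ)) :
    Measurable fun t => q t * f (projIcc 0 l hl t) :=
  hq.mul (f.continuous.comp continuous_projIcc).measurable

/-! ### Volterra operators -/

section Volterra

variable {l : ℝ} (hl : 0 ≤ l) {q : ℝ → ℂ} (hq : Measurable q) {C : ℝ} (hC : ∀ t, ‖q t‖ ≤ C)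

/-- The Volterra operator `f ↦ (x ↦ ∫ t in 0..x, q t * f t)` on the continuous functions on
`[0, l]`, for a bounded measurable `q`. -/
def volterra : C(Icc 0 l, ℂ) →L[ℂ] C(Icc 0 l, ℂ) :=
  LinearMap.mkContinuous
    { toFun := fun f =>
        ⟨fun x => ∫ t in (0 : ℝ)..x, q t * f (projIcc 0 l hl t),
          (lipschitzWith_integral (measurable_mul_projIcc hl hq f)
            (norm_mul_projIcc_le hl hC f) 0).continuous.comp continuous_subtype_val⟩
      map_add' := fun f g => by
        ext x
        simp only [ContinuousMap.coe_mk, ContinuousMap.add_apply, mul_add]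
        exact intervalIntegral.integral_add
          (intervalIntegrable_of_measurable_of_norm_le (measurable_mul_projIcc hl hq f)
            (norm_mul_projIcc_le hl hC f) _ _)
          (intervalIntegrable_of_measurable_of_norm_le (measurable_mul_projIcc hl hq g)
            (norm_mul_projIcc_le hl hC g) _ _)
      map_smul' := fun c f => by
        ext x
        simp only [ContinuousMap.coe_mk, ContinuousMap.smul_apply, smul_eq_mul, RingHom.id_apply]
        rw [← intervalIntegral.integral_const_mul]
        exact intervalIntegral.integral_congr fun t _ => by ring }
    (C * l) fun f => by
      have hC0 : 0 ≤ C := (norm_nonneg _).trans (hC 0)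
      refine (ContinuousMap.norm_le _ (by positivity)).2 fun x => ?_
      refine (intervalIntegral.norm_integral_le_of_norm_le_const
        fun t _ => norm_mul_projIcc_le hl hC f t).trans ?_
      rw [sub_zero, abs_of_nonneg x.2.1, mul_right_comm]
      exact mul_le_mul_of_nonneg_right (mul_le_mul_of_nonneg_left x.2.2 hC0) (norm_nonneg f)

theorem volterra_apply (f : C(Icc 0 l, ℂ)) (x : Icc 0 l) :
    volterra hl hq hC f x = ∫ t in (0 : ℝ)..x, q t * f (projIcc 0 l hl t) := rfl

/-- Multiplication by `x ↦ exp (κ * x)` on the continuous functions on `[0, l]`. -/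
def expWeight (l κ : ℝ) : C(Icc 0 l, ℂ) →L[ℂ] C(Icc 0 l, ℂ) :=
  ContinuousLinearMap.mul ℂ C(Icc 0 l, ℂ)
    ⟨fun x => ((Real.exp (κ * x) : ℝ) : ℂ), by fun_prop⟩

theorem expWeight_apply (κ : ℝ) (f : C(Icc 0 l, ℂ)) (x : Icc 0 l) :
    expWeight l κ f x = ((Real.exp (κ * x) : ℝ) : ℂ) * f x := rfl

theorem expWeight_mul_neg (l κ : ℝ) : expWeight l κ * expWeight l (-κ) = 1 := by
  ext f x
  simp only [mul_apply_eq_comp, expWeight_apply, one_apply_eq_self]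
  rw [← mul_assoc, ← Complex.ofReal_mul, ← Real.exp_add]
  simp

theorem expWeight_neg_mul (l κ : ℝ) : expWeight l (-κ) * expWeight l κ = 1 := by
  simpa using expWeight_mul_neg l (-κ)

/-- The exponential weight makes a Volterra operator small, since exp(-κx) ∫₀ˣ exp(κt) dt ≤ 1/κ. -/
theorem norm_conj_volterra_le {κ : ℝ} (hκ : 0 < κ) :
    ‖expWeight l (-κ) * volterra hl hq hC * expWeight l κ‖ ≤ C / κ := by
  have hC0 : 0 ≤ C := (norm_nonneg _).trans (hC 0)
  refine ContinuousLinearMap.opNorm_le_bound _ (by positivity) fun f => ?_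
  refine (ContinuousMap.norm_le _ (by positivity)).2 fun x => ?_
  simp only [mul_apply_eq_comp, expWeight_apply, volterra_apply]
  have key : ‖∫ t in (0 : ℝ)..x, q t *
      (((Real.exp (κ * (projIcc 0 l hl t : ℝ)) : ℝ) : ℂ) * f (projIcc 0 l hl t))‖ ≤
      ∫ t in (0 : ℝ)..x, C * ‖f‖ * Real.exp (κ * t) := by
    refine intervalIntegral.norm_integral_le_of_norm_le x.2.1
      (Eventually.of_forall fun t ht => ?_)
      (Continuous.intervalIntegrable (by fun_prop) _ _)
    rw [projIcc_of_mem hl ⟨ht.1.le, ht.2.trans x.2.2⟩, norm_mul, norm_mul, Complex.norm_real,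
      Real.norm_of_nonneg (Real.exp_pos _).le, mul_left_comm, mul_comm (Real.exp _)]
    exact mul_le_mul_of_nonneg_right (mul_le_mul (hC t) (f.norm_coe_le_norm _) (norm_nonneg _) hC0)
      (Real.exp_pos _).le
  have hint : ∫ t in (0 : ℝ)..x, C * ‖f‖ * Real.exp (κ * t) =
      C * ‖f‖ * ((Real.exp (κ * x) - 1) / κ) := by
    rw [intervalIntegral.integral_const_mul,
      intervalIntegral.integral_comp_mul_left (fun t => Real.exp t) hκ.ne', integral_exp]
    simp [div_eq_inv_mul]
  rw [norm_mul, Complex.norm_real, Real.norm_of_nonneg (Real.exp_pos _).le]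
  refine (mul_le_mul_of_nonneg_left (key.trans_eq hint) (Real.exp_pos _).le).trans ?_
  have h1 : Real.exp (-κ * x) * (Real.exp (κ * x) - 1) ≤ 1 := by
    rw [mul_sub, ← Real.exp_add]
    simp
    linarith [Real.exp_pos (-(κ * x))]
  calc Real.exp (-κ * x) * (C * ‖f‖ * ((Real.exp (κ * x) - 1) / κ))
      = (C * ‖f‖ / κ) * (Real.exp (-κ * x) * (Real.exp (κ * x) - 1)) := by ring
    _ ≤ (C * ‖f‖ / κ) * 1 := by gcongr
    _ = C / κ * ‖f‖ := by ring

/-- Conjugation by `M` turns the claim into the convergence of a Neumann series. -/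
theorem isUnit_one_sub_mul_of_norm_conj_lt_one {R : Type*} [NormedRing R] [HasSummableGeomSeries R]
    {M M' S T : R} (h1 : M * M' = 1) (h2 : M' * M = 1)
    (hn : ‖(M' * S * M) * (M' * T * M)‖ < 1) : IsUnit (1 - S * T) := by
  have hM : IsUnit M := ⟨⟨M, M', h1, h2⟩, rfl⟩
  have hM' : IsUnit M' := ⟨⟨M', M, h2, h1⟩, rfl⟩
  have e : 1 - S * T = M * (1 - (M' * S * M) * (M' * T * M)) * M' := by
    calc 1 - S * T = M * M' - (M * M') * S * (M * M') * T * (M * M') := by rw [h1]; simp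
      _ = _ := by noncomm_ring
  rw [e]
  exact (hM.mul (isUnit_one_sub_of_norm_lt_one hn)).mul hM'

theorem isUnit_one_sub_volterra_mul_volterra {r : ℝ → ℂ} (hr : Measurable r) {D : ℝ}
    (hD : ∀ t, ‖r t‖ ≤ D) : IsUnit (1 - volterra hl hr hD * volterra hl hq hC) := by
  have hC0 : 0 ≤ C := (norm_nonneg _).trans (hC 0)
  have hD0 : 0 ≤ D := (norm_nonneg _).trans (hD 0)
  -- Larger than both bounds, so that both conjugated operators have norm below one.
  set κ : ℝ := C + D + 1
  have hκ : 0 < κ := by positivity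
  set M := expWeight l κ
  set M' := expWeight l (-κ)
  have h1 : M * M' = 1 := expWeight_mul_neg l κ
  have h2 : M' * M = 1 := expWeight_neg_mul l κ
  set S := volterra hl hr hD
  set T := volterra hl hq hC
  have hn : ‖(M' * S * M) * (M' * T * M)‖ < 1 := by
    refine (norm_mul_le (M' * S * M) (M' * T * M)).trans_lt ?_
    have hS : ‖M' * S * M‖ ≤ D / κ := norm_conj_volterra_le hl hr hD hκ
    have hT : ‖M' * T * M‖ ≤ C / κ := norm_conj_volterra_le hl hq hC hκ
    have hS1 : D / κ < 1 := (div_lt_one hκ).2 (by linarith)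
    have hT1 : C / κ < 1 := (div_lt_one hκ).2 (by linarith)
    have : 0 ≤ D / κ := by positivity
    have h0 := norm_nonneg (M' * S * M)
    have h0' := norm_nonneg (M' * T * M)
    nlinarith
  exact isUnit_one_sub_mul_of_norm_conj_lt_one (R := C(Icc 0 l, ℂ) →L[ℂ] C(Icc 0 l, ℂ)) h1 h2 hn

end Volterra

/-! ### The equation on an edge: existence and analytic dependence on z -/

theorem Differentiable.ringInverse {R : Type*} [NormedRing R] [HasSummableGeomSeries R]
    [NormedAlgebra ℂ R] {f : ℂ → R} (hf : Differentiable ℂ f) (hu : ∀ z, IsUnit (f z)) :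
    Differentiable ℂ fun z => Ring.inverse (f z) := fun z =>
  (differentiableAt_inverse (𝕜 := ℂ) (hu z)).comp z (hf z)

theorem differentiable_quadratic_smul {F : Type*} [NormedAddCommGroup F] [NormedSpace ℂ F]
    (A B D : F) : Differentiable ℂ fun z : ℂ => z ^ 2 • A + (2 * z) • B - D := by
  fun_prop

theorem ae_hasDerivAt_integral_of_norm_le {f : ℝ → ℂ} (hf : Measurable f) {C : ℝ}
    (hC : ∀ t, ‖f t‖ ≤ C) :
    ∀ᵐ x, ∀ c, HasDerivAt (fun x => ∫ t in c..x, f t) (f x) x := by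
  refine LocallyIntegrable.ae_hasDerivAt_integral ?_
  refine (locallyIntegrable_const C).mono hf.aestronglyMeasurable
    (Eventually.of_forall fun t => (hC t).trans (le_abs_self C))

/-- A damping function and a potential on an edge, extended to bounded measurable functions on the
whole line. -/
structure EdgeCoeff where
  a : ℝ → ℝ
  b : ℝ → ℝ
  bound : ℝ
  measurable_a : Measurable a
  measurable_b : Measurable b
  abs_a_le : ∀ t, |a t| ≤ bound
  abs_b_le : ∀ t, |b t| ≤ bound

namespace EdgeCoeff

variable (c : EdgeCoeff)

theorem bound_nonneg : 0 ≤ c.bound := (abs_nonneg _).trans (c.abs_a_le 0)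

/-- The coefficient `q` in the equation `u'' = q u` satisfied by the first component of an
eigenfunction with eigenvalue `z`. -/
def q (z : ℂ) (t : ℝ) : ℂ := z ^ 2 + 2 * z * c.a t - c.b t

theorem measurable_ofReal_a : Measurable fun t => (c.a t : ℂ) :=
  Complex.measurable_ofReal.comp c.measurable_a

theorem measurable_ofReal_b : Measurable fun t => (c.b t : ℂ) :=
  Complex.measurable_ofReal.comp c.measurable_b

theorem measurable_q (z : ℂ) : Measurable (c.q z) :=
  (measurable_const.add (c.measurable_ofReal_a.const_mul _)).sub c.measurable_ofReal_b

theorem norm_ofReal_a_le (t : ℝ) : ‖(c.a t : ℂ)‖ ≤ c.bound := by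
  rw [Complex.norm_real]; exact c.abs_a_le t

theorem norm_ofReal_b_le (t : ℝ) : ‖(c.b t : ℂ)‖ ≤ c.bound := by
  rw [Complex.norm_real]; exact c.abs_b_le t

theorem norm_q_le (z : ℂ) (t : ℝ) : ‖c.q z t‖ ≤ ‖z‖ ^ 2 + 2 * ‖z‖ * c.bound + c.bound := by
  refine (norm_sub_le _ _).trans (add_le_add ((norm_add_le _ _).trans (add_le_add ?_ ?_))
    (c.norm_ofReal_b_le t))
  · rw [norm_pow]
  · rw [norm_mul, norm_mul]
    simpa using mul_le_mul_of_nonneg_left (c.abs_a_le t) (by positivity : 0 ≤ 2 * ‖z‖)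

/-- `u`, with derivative `p`, solves `u'' = q u` on `[0, l]`. -/
structure IsEdgeSolution (l : ℝ) (z : ℂ) (u p : ℝ → ℂ) : Prop where
  hasDerivAt : ∀ x, HasDerivAt u (p x) x
  lipschitz : ∃ K, LipschitzWith K p
  ae_hasDerivAt : ∀ᵐ x, x ∈ Icc 0 l → HasDerivAt p (c.q z x * u x) x

theorem IsEdgeSolution.linearCombination {c : EdgeCoeff} {l : ℝ} {z : ℂ} {u p v r : ℝ → ℂ}
    (h : c.IsEdgeSolution l z u p) (k : c.IsEdgeSolution l z v r) (α β : ℂ) :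
    c.IsEdgeSolution l z (fun x => α * u x + β * v x) (fun x => α * p x + β * r x) where
  hasDerivAt x := ((h.hasDerivAt x).const_mul α).add ((k.hasDerivAt x).const_mul β)
  lipschitz := by
    obtain ⟨K, hK⟩ := h.lipschitz
    obtain ⟨L, hL⟩ := k.lipschitz
    exact ⟨_, ((lipschitzWith_smul α).comp hK).add ((lipschitzWith_smul β).comp hL)⟩
  ae_hasDerivAt := by
    filter_upwards [h.ae_hasDerivAt, k.ae_hasDerivAt] with x h1 h2 hx
    exact (((h1 hx).const_mul α).add ((h2 hx).const_mul β)).congr_deriv (by ring)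

/-- Integration from `0`, as an operator on the continuous functions on `[0, l]`. -/
def integrationOp {l : ℝ} (hl : 0 ≤ l) : C(Icc 0 l, ℂ) →L[ℂ] C(Icc 0 l, ℂ) :=
  volterra hl (q := fun _ => 1) measurable_const (C := 1) (fun _ => by simp)

/-- The operator `f ↦ (x ↦ ∫ t in 0..x, q t * f t)`. -/
def potentialOp {l : ℝ} (hl : 0 ≤ l) (z : ℂ) :
    C(Icc 0 l, ℂ) →L[ℂ] C(Icc 0 l, ℂ) :=
  volterra hl (c.measurable_q z) (c.norm_q_le z)

/-- A quadratic polynomial in z with fixed bounded operators as coefficients is visibly entire. -/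
theorem potentialOp_eq {l : ℝ} (hl : 0 ≤ l) (z : ℂ) :
    c.potentialOp hl z = z ^ 2 • integrationOp hl +
    (2 * z) • volterra hl c.measurable_ofReal_a c.norm_ofReal_a_le -
      volterra hl c.measurable_ofReal_b c.norm_ofReal_b_le := by
  ext f x
  simp only [potentialOp, integrationOp, sub_apply, add_apply, smul_apply, volterra_apply,
    ContinuousMap.sub_apply, ContinuousMap.add_apply, ContinuousMap.smul_apply, smul_eq_mul]
  have hi : ∀ {r : ℝ → ℂ} (hr : Measurable r) {C : ℝ} (hC : ∀ t, ‖r t‖ ≤ C),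
      IntervalIntegrable (fun t => r t * f (projIcc 0 l hl t)) volume 0 x := fun hr _ hC =>
    intervalIntegrable_of_measurable_of_norm_le (measurable_mul_projIcc hl hr f)
      (norm_mul_projIcc_le hl hC f) _ _
  have h1 := hi (r := fun _ => 1) measurable_const (C := 1) (fun _ => by simp)
  have h2 := hi c.measurable_ofReal_a c.norm_ofReal_a_le
  have h3 := hi c.measurable_ofReal_b c.norm_ofReal_b_le
  rw [← intervalIntegral.integral_const_mul, ← intervalIntegral.integral_const_mul,
    ← intervalIntegral.integral_add (h1.const_mul _) (h2.const_mul _),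
    ← intervalIntegral.integral_sub ((h1.const_mul _).add (h2.const_mul _)) h3]
  refine intervalIntegral.integral_congr fun t _ => ?_
  simp only [q]
  ring

theorem differentiable_potentialOp {l : ℝ} (hl : 0 ≤ l) : Differentiable ℂ (c.potentialOp hl) := by
  rw [show c.potentialOp hl = _ from funext (c.potentialOp_eq hl)]
  exact differentiable_quadratic_smul (F := C(Icc 0 l, ℂ) →L[ℂ] C(Icc 0 l, ℂ)) _ _ _

theorem differentiable_inverse_one_sub {l : ℝ} (hl : 0 ≤ l) :
    Differentiable ℂ fun z =>
    Ring.inverse (1 - integrationOp hl * c.potentialOp hl z) := by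
  refine Differentiable.ringInverse (R := C(Icc 0 l, ℂ) →L[ℂ] C(Icc 0 l, ℂ)) ?_
    fun z => isUnit_one_sub_volterra_mul_volterra hl _ _ _ _
  exact ((c.differentiable_potentialOp hl).const_mul
    (𝔸 := C(Icc 0 l, ℂ) →L[ℂ] C(Icc 0 l, ℂ)) (integrationOp hl)).const_sub
      (1 : C(Icc 0 l, ℂ) →L[ℂ] C(Icc 0 l, ℂ))

/-- For given initial data, the equation `u'' = q u` has a solution on `[0, l]`, and its data at `l`
are entire functions of `z`. -/
theorem exists_isEdgeSolution {l : ℝ} (hl : 0 ≤ l) (u₀ p₀ : ℂ) :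
    ∃ u p : ℂ → ℝ → ℂ,
    (∀ z, c.IsEdgeSolution l z (u z) (p z) ∧ u z 0 = u₀ ∧ p z 0 = p₀) ∧
      Differentiable ℂ (fun z => u z l) ∧ Differentiable ℂ (fun z => p z l) := by
  let g : C(Icc 0 l, ℂ) := ⟨fun x => u₀ + p₀ * ((x : ℝ) : ℂ), by fun_prop⟩
  -- The equation in integral form is U = g + ∫∫ qU, where g is the affine function with the given
  -- initial data.
  let U : ℂ → C(Icc 0 l, ℂ) := fun z =>
    Ring.inverse (1 - integrationOp hl * c.potentialOp hl z) g
  have hU : ∀ z, U z = g + integrationOp hl (c.potentialOp hl z (U z)) := fun z => by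
    have hu : IsUnit (1 - integrationOp hl * c.potentialOp hl z) :=
      isUnit_one_sub_volterra_mul_volterra hl _ _ _ _
    have h := congrArg (fun T : C(Icc 0 l, ℂ) →L[ℂ] C(Icc 0 l, ℂ) => T g)
      (Ring.mul_inverse_cancel _ hu)
    exact sub_eq_iff_eq_add.1 h
  have hUd : Differentiable ℂ U := fun z =>
    (c.differentiable_inverse_one_sub hl z).clm_apply (differentiableAt_const _)
  have hPd : Differentiable ℂ fun z => c.potentialOp hl z (U z) := fun z =>
    (c.differentiable_potentialOp hl z).clm_apply (hUd z)
  have hev : ∀ {F : ℂ → C(Icc 0 l, ℂ)}, Differentiable ℂ F → ∀ x : Icc 0 l,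
      Differentiable ℂ fun z => F z x := fun hF x =>
    (ContinuousMap.evalCLM ℂ x : C(Icc 0 l, ℂ) →L[ℂ] ℂ).differentiable.comp hF
  -- Extending `U z` constantly beyond [0, l] defines u and p on the whole line, so that two-sided
  -- derivatives exist at the endpoints as well.
  let f : ℂ → ℝ → ℂ := fun z t => c.q z t * U z (projIcc 0 l hl t)
  have hfm : ∀ z, Measurable (f z) := fun z => measurable_mul_projIcc hl (c.measurable_q z) _
  have hfb := fun z => norm_mul_projIcc_le hl (c.norm_q_le z) (U z)
  let p : ℂ → ℝ → ℂ := fun z x => p₀ + ∫ t in (0 : ℝ)..x, f z t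
  have hpl : ∀ z, ∃ K, LipschitzWith K (p z) := fun z =>
    ⟨_, (LipschitzWith.const p₀).add (lipschitzWith_integral (hfm z) (hfb z) 0)⟩
  have hpc : ∀ z, Continuous (p z) := fun z => (hpl z).choose_spec.continuous
  let u : ℂ → ℝ → ℂ := fun z x => u₀ + ∫ t in (0 : ℝ)..x, p z t
  have hu : ∀ z, ∀ x (hx : x ∈ Icc 0 l), u z x = U z ⟨x, hx⟩ := fun z x hx => by
    have e : ∫ t in (0 : ℝ)..x, p z t =
        p₀ * x + ∫ t in (0 : ℝ)..x, ∫ s in (0 : ℝ)..t, f z s := by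
      simp only [p]
      rw [intervalIntegral.integral_add intervalIntegrable_const
        ((lipschitzWith_integral (hfm z) (hfb z) 0).continuous.intervalIntegrable _ _)]
      simp [mul_comm]
    rw [hU z]
    simp only [u, e, ContinuousMap.add_apply, g, ContinuousMap.coe_mk, integrationOp,
      volterra_apply, one_mul, ← add_assoc]
    congr 1
    refine intervalIntegral.integral_congr fun t ht => ?_
    rw [uIcc_of_le hx.1] at ht
    have ht' : t ∈ Icc 0 l := ⟨ht.1, ht.2.trans hx.2⟩
    simp only [projIcc_of_mem hl ht', potentialOp, volterra_apply, f]
  refine ⟨u, p, fun z => ⟨⟨fun x => ?_, hpl z, ?_⟩, by simp [u], by simp [p]⟩, ?_, ?_⟩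
  · exact ((hpc z).integral_hasStrictDerivAt 0 x).hasDerivAt.const_add u₀
  · filter_upwards [ae_hasDerivAt_integral_of_norm_le (hfm z) (hfb z)] with x hx hxl
    rw [hu z x hxl, ← projIcc_of_mem hl hxl]
    exact (hx 0).const_add p₀
  · rw [show (fun z => u z l) = fun z => U z ⟨l, right_mem_Icc.2 hl⟩ from
      funext fun z => hu z l (right_mem_Icc.2 hl)]
    exact hev hUd _
  · exact (hev hPd ⟨l, right_mem_Icc.2 hl⟩).const_add p₀

end EdgeCoeff

/-! ### Uniform convergence, Grönwall and absolute continuity -/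

/-- On a compact space, pointwise convergence of an equicontinuous family is uniform. -/
theorem eventually_forall_norm_le_of_lipschitzWith {X : Type*} [PseudoMetricSpace X]
    [CompactSpace X] {F : ℕ → X → ℂ} {K : NNReal} (hF : ∀ n, LipschitzWith K (F n))
    (h : ∀ x, Tendsto (fun n => F n x) atTop (𝓝 0)) {ε : ℝ} (hε : 0 < ε) :
    ∀ᶠ n in atTop, ∀ x, ‖F n x‖ ≤ ε := by
  have h1 := ((LipschitzWith.uniformEquicontinuous F K hF).equicontinuous.tendsto_uniformFun_iff_pi
    atTop (fun _ => (0 : ℂ))).2 (tendsto_pi_nhds.2 h)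
  rw [UniformFun.tendsto_iff_tendstoUniformly, Metric.tendstoUniformly_iff] at h1
  filter_upwards [h1 ε hε] with n hn x
  have := hn x
  rw [dist_comm, dist_eq_norm] at this
  simpa using this.le

/-- The differential Grönwall inequality applies to the right-hand side, which is differentiable
although `Y` need not be. -/
theorem le_mul_exp_of_le_add_integral {Y : ℝ → ℝ} {l δ L : ℝ} (hY : Continuous Y) (hL : 0 ≤ L)
    (h : ∀ x ∈ Icc 0 l, Y x ≤ δ + L * ∫ t in (0 : ℝ)..x, Y t) {x : ℝ} (hx : x ∈ Icc 0 l) :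
    Y x ≤ δ * Real.exp (L * x) := by
  set φ : ℝ → ℝ := fun x => δ + L * ∫ t in (0 : ℝ)..x, Y t with hφ
  have hd : ∀ x, HasDerivAt φ (L * Y x) x := fun x =>
    ((hY.integral_hasStrictDerivAt 0 x).hasDerivAt.const_mul L).const_add δ
  have key : φ x ≤ gronwallBound δ L 0 (x - 0) := by
    refine le_gronwallBound_of_liminf_deriv_right_le (f := φ) (f' := fun x => L * Y x) (b := l)
      (fun x _ => (hd x).continuousAt.continuousWithinAt) (fun x _ r hr =>
        (hd x).hasDerivWithinAt.liminf_right_slope_le hr) (by simp [hφ]) (fun x hx => ?_) x hx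
    simpa using mul_le_mul_of_nonneg_left (h x ⟨hx.1, hx.2.le⟩) hL
  rw [gronwallBound_ε0, sub_zero] at key
  exact (h x hx).trans key

theorem AbsolutelyContinuousOnInterval.sub_eq_integral_of_ae_hasDerivAt {f h : ℝ → ℂ} {l D : ℝ}
    (hl : 0 ≤ l) (hf : AbsolutelyContinuousOnInterval f 0 l) (hm : Measurable h)
    (hD : ∀ t ∈ Icc 0 l, ‖h t‖ ≤ D) (hd : ∀ᵐ x, x ∈ Icc 0 l → HasDerivAt f (h x) x)
    {x : ℝ} (hx : x ∈ Icc 0 l) : f x - f 0 = ∫ t in (0 : ℝ)..x, h t := by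
  -- Truncation makes the bound global, so the integral of `g` is Lipschitz; its difference with `f`
  -- is absolutely continuous with zero derivative almost everywhere.
  set g : ℝ → ℂ := (Icc 0 l).indicator h with hg
  have hD0 : 0 ≤ D := (norm_nonneg _).trans (hD 0 ⟨le_rfl, hl⟩)
  have hgm : Measurable g := hm.indicator measurableSet_Icc
  have hgD : ∀ t, ‖g t‖ ≤ D := fun t => by
    by_cases ht : t ∈ Icc 0 l
    · simpa [hg, indicator_of_mem ht] using hD t ht
    · simpa [hg, indicator_of_notMem ht] using hD0
  have hac := hf.sub ((lipschitzWith_integral hgm hgD 0).lipschitzOnWith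
    (s := uIcc 0 l)).absolutelyContinuousOnInterval
  obtain ⟨k, hk⟩ := hac.const_of_ae_hasDerivAt_zero (by
    filter_upwards [hd, ae_hasDerivAt_integral_of_norm_le hgm hgD] with t h1 h2 ht
    rw [uIcc_of_le hl] at ht
    have h3 := (h1 ht).sub (h2 0)
    rwa [hg, indicator_of_mem ht, sub_self] at h3)
  rw [uIcc_of_le hl] at hk
  have e1 := hk x hx
  have e0 := hk 0 ⟨le_rfl, hl⟩
  simp only [Pi.sub_apply, intervalIntegral.integral_same, sub_zero] at e1 e0
  rw [e0, ← e1, sub_sub_cancel]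
  refine intervalIntegral.integral_congr fun t ht => ?_
  rw [uIcc_of_le hx.1] at ht
  have ht' : t ∈ Icc 0 l := ⟨ht.1, ht.2.trans hx.2⟩
  simp only [hg, indicator_of_mem ht']

theorem lipschitzOnWith_cexp (R : ℝ) :
    LipschitzOnWith (Real.exp R).toNNReal Complex.exp {z | z.re ≤ R} := by
  refine (convex_halfSpace_re_le R).lipschitzOnWith_of_nnnorm_deriv_le (𝕜 := ℂ)
    (fun z _ => Complex.differentiableAt_exp) fun z hz => ?_
  rw [Complex.deriv_exp, ← NNReal.coe_le_coe, coe_nnnorm, Complex.norm_exp,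
    Real.coe_toNNReal _ (Real.exp_pos R).le]
  exact Real.exp_le_exp.2 hz

/-! ### The exponential factors and their oscillation -/

namespace EdgeCoeff

variable (c : EdgeCoeff)

/-- The primitive of the damping function. -/
def primitive (x : ℝ) : ℂ := ∫ t in (0 : ℝ)..x, (c.a t : ℂ)

theorem lipschitzWith_primitive : LipschitzWith c.bound.toNNReal c.primitive :=
  lipschitzWith_integral c.measurable_ofReal_a c.norm_ofReal_a_le 0

theorem norm_primitive_le {l x : ℝ} (hx : x ∈ Icc 0 l) : ‖c.primitive x‖ ≤ c.bound * l := by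
  refine (intervalIntegral.norm_integral_le_of_norm_le_const
    fun t _ => c.norm_ofReal_a_le t).trans ?_
  rw [sub_zero, abs_of_nonneg hx.1]
  exact mul_le_mul_of_nonneg_left hx.2 c.bound_nonneg

/-- The function `x ↦ exp (s * (σ * x + ∫ t in 0..x, a t))`. -/
def expo (σ : ℂ) (s x : ℝ) : ℂ := Complex.exp (s * (σ * x + c.primitive x))

theorem expo_add (σ : ℂ) (s r x : ℝ) : c.expo σ (s + r) x = c.expo σ s x * c.expo σ r x := by
  rw [expo, expo, expo, ← Complex.exp_add]
  push_cast
  ring_nf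

theorem expo_neg_mul (σ : ℂ) (s x : ℝ) : c.expo σ (-s) x * c.expo σ s x = 1 := by
  rw [← expo_add]; simp [expo]

theorem continuous_expo (σ : ℂ) (s : ℝ) : Continuous (c.expo σ s) := by
  have := c.lipschitzWith_primitive.continuous
  unfold expo
  fun_prop

theorem exponent_re_le (σ : ℂ) {s l x : ℝ} (hx : x ∈ Icc 0 l) :
    ((s : ℂ) * (σ * x + c.primitive x)).re ≤ |s| * ((|σ.re| + c.bound) * l) := by
  have h1 : ((s : ℂ) * (σ * x + c.primitive x)).re = s * (σ.re * x + (c.primitive x).re) := by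
    simp
  rw [h1]
  refine (le_abs_self _).trans ?_
  rw [abs_mul]
  refine mul_le_mul_of_nonneg_left ((abs_add_le _ _).trans ?_) (abs_nonneg _)
  rw [add_mul, abs_mul, abs_of_nonneg hx.1]
  exact add_le_add (mul_le_mul_of_nonneg_left hx.2 (abs_nonneg _))
    ((Complex.abs_re_le_norm _).trans (c.norm_primitive_le hx))

theorem norm_expo_le (σ : ℂ) {s l x : ℝ} (hx : x ∈ Icc 0 l) :
    ‖c.expo σ s x‖ ≤ Real.exp (|s| * ((|σ.re| + c.bound) * l)) := by
  rw [expo, Complex.norm_exp]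
  exact Real.exp_le_exp.2 (c.exponent_re_le σ hx)

theorem absolutelyContinuousOnInterval_expo (σ : ℂ) (s : ℝ) {l : ℝ} (hl : 0 ≤ l) :
    AbsolutelyContinuousOnInterval (c.expo σ s) 0 l := by
  have h1 : ∃ K, LipschitzWith K fun x : ℝ => (s : ℂ) * (σ * x + c.primitive x) :=
    ⟨_, (lipschitzWith_smul (s : ℂ)).comp
      (((lipschitzWith_smul σ).comp Complex.isometry_ofReal.lipschitz).add
        c.lipschitzWith_primitive)⟩
  obtain ⟨K, hK⟩ := h1
  refine LipschitzOnWith.absolutelyContinuousOnInterval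
    ((lipschitzOnWith_cexp (|s| * ((|σ.re| + c.bound) * l))).comp hK.lipschitzOnWith
      fun x hx => ?_)
  rw [uIcc_of_le hl] at hx
  exact c.exponent_re_le σ hx

theorem ae_hasDerivAt_expo (σ : ℂ) (s : ℝ) :
    ∀ᵐ x, HasDerivAt (c.expo σ s) (s * (σ + c.a x) * c.expo σ s x) x := by
  filter_upwards [ae_hasDerivAt_integral_of_norm_le c.measurable_ofReal_a c.norm_ofReal_a_le]
    with x hx
  have h1 : HasDerivAt (fun x : ℝ => (s : ℂ) * (σ * x + c.primitive x)) (s * (σ + c.a x)) x := by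
    exact ((((Complex.ofRealCLM.hasDerivAt (x := x)).const_mul σ).add (hx 0)).const_mul
      (s : ℂ)).congr_deriv (by simp)
  exact (h1.cexp).congr_deriv (by rw [expo]; ring)

/-- A Riemann–Lebesgue lemma, uniform in the upper limit of integration. -/
theorem eventually_norm_integral_expo_le (μ : ℂ) {s : ℝ} (hs : s ≠ 0) (l : ℝ) {ε : ℝ}
    (hε : 0 < ε) : ∀ᶠ n : ℕ in atTop, ∀ x ∈ Icc 0 l,
      ‖∫ t in (0 : ℝ)..x, (c.a t : ℂ) * c.expo (μ + 2 * Real.pi * Complex.I * n) s t‖ ≤ ε := by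
  set B := c.bound * Real.exp (|s| * ((|μ.re| + c.bound) * l))
  -- The shift by 2πin leaves the real part unchanged, so the Lipschitz constant `B` does not depend
  -- on n.
  have hre : ∀ n : ℕ, (μ + 2 * Real.pi * Complex.I * n).re = μ.re := fun n => by simp
  have hm : ∀ σ, Measurable fun t => (c.a t : ℂ) * c.expo σ s t := fun σ =>
    c.measurable_ofReal_a.mul (c.continuous_expo σ s).measurable
  have hlip : ∀ n : ℕ, LipschitzWith B.toNNReal fun x : Icc 0 l =>
      ∫ t in (0 : ℝ)..x, (c.a t : ℂ) * c.expo (μ + 2 * Real.pi * Complex.I * n) s t := by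
    intro n
    refine LipschitzWith.of_dist_le_mul fun x y => ?_
    have hint : ∀ z : Icc 0 l, IntervalIntegrable
        (fun t => (c.a t : ℂ) * c.expo (μ + 2 * Real.pi * Complex.I * n) s t) volume 0 z := fun z =>
      (intervalIntegrable_of_measurable_of_norm_le c.measurable_ofReal_a
        c.norm_ofReal_a_le _ _).mul_continuousOn (c.continuous_expo _ _).continuousOn
    rw [dist_eq_norm, intervalIntegral.integral_interval_sub_left (hint x) (hint y),
      Real.coe_toNNReal _ (mul_nonneg c.bound_nonneg (Real.exp_pos _).le), Subtype.dist_eq,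
      Real.dist_eq]
    refine intervalIntegral.norm_integral_le_of_norm_le_const fun t ht => ?_
    have ht' : t ∈ Icc 0 l := (ordConnected_Icc.uIcc_subset y.2 x.2) (uIoc_subset_uIcc ht)
    rw [norm_mul]
    refine mul_le_mul (c.norm_ofReal_a_le t) ?_ (norm_nonneg _) c.bound_nonneg
    simpa [hre] using c.norm_expo_le (μ + 2 * Real.pi * Complex.I * n) (s := s) ht'
  have hlim : ∀ x : Icc 0 l, Tendsto (fun n : ℕ =>
      ∫ t in (0 : ℝ)..x, (c.a t : ℂ) * c.expo (μ + 2 * Real.pi * Complex.I * n) s t)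
      atTop (𝓝 0) := by
    intro x
    -- The n-dependence of the integrand is the factor exp(2πisnt), so the integral is a Fourier
    -- transform at the frequency -sn.
    have h1 : Tendsto (fun n : ℕ => -s * (n : ℝ)) atTop (cocompact ℝ) :=
      (Homeomorph.mulLeft₀ (-s) (neg_ne_zero.2 hs)).isClosedEmbedding.tendsto_cocompact.comp
        (tendsto_natCast_atTop_atTop.mono_right atTop_le_cocompact)
    refine ((Real.tendsto_integral_exp_smul_cocompact
      ((Ioc 0 (x : ℝ)).indicator fun t => (c.a t : ℂ) * c.expo μ s t)).comp h1).congr fun n => ?_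
    rw [intervalIntegral.integral_of_le x.2.1, ← integral_indicator measurableSet_Ioc]
    refine integral_congr_ae (Eventually.of_forall fun t => ?_)
    by_cases ht : t ∈ Ioc 0 (x : ℝ)
    · simp only [indicator_of_mem ht, Circle.smul_def, Real.fourierChar_apply, smul_eq_mul, expo]
      rw [mul_left_comm, ← Complex.exp_add]
      congr 2
      push_cast
      ring
    · simp [indicator_of_notMem ht]
  filter_upwards [eventually_forall_norm_le_of_lipschitzWith hlip hlim hε] with n hn x hx
  exact hn ⟨x, hx⟩

end EdgeCoeff

/-! ### Amplitudes and their Grönwall estimate -/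

namespace EdgeCoeff

variable {c : EdgeCoeff}

/-- The amplitudes (for `s = 1` and `s = -1`) of a solution with respect to the approximate
solutions `exp (± (σ * x + ∫ t in 0..x, a t))`. -/
def amplitude (c : EdgeCoeff) (σ z : ℂ) (u p : ℝ → ℂ) (s x : ℝ) : ℂ :=
  c.expo σ (-s) x * (u x + s * (p x / z))

/-- The derivative of an amplitude. -/
def amplitudeDeriv (c : EdgeCoeff) (σ z : ℂ) (u p : ℝ → ℂ) (s x : ℝ) : ℂ :=
  s * ((z - σ) * c.amplitude σ z u p s x
    + c.a x * c.expo σ (-2 * s) x * c.amplitude σ z u p (-s) x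
    - c.b x / (2 * z) *
      (c.amplitude σ z u p s x + c.expo σ (-2 * s) x * c.amplitude σ z u p (-s) x))

namespace IsEdgeSolution

variable {l : ℝ} {σ z : ℂ} {u p : ℝ → ℂ}

theorem continuous_amplitude (h : c.IsEdgeSolution l z u p) (s : ℝ) :
    Continuous (c.amplitude σ z u p s) := by
  have h1 := c.continuous_expo σ (-s)
  have h2 : Continuous u := continuous_iff_continuousAt.2 fun x => (h.hasDerivAt x).continuousAt
  have h3 : Continuous p := h.lipschitz.choose_spec.continuous
  unfold amplitude
  fun_prop

theorem absolutelyContinuousOnInterval_amplitude (h : c.IsEdgeSolution l z u p) (hl : 0 ≤ l)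
    (s : ℝ) : AbsolutelyContinuousOnInterval (c.amplitude σ z u p s) 0 l := by
  obtain ⟨K, hK⟩ := h.lipschitz
  have hu : ContDiff ℝ 1 u := by
    refine contDiff_one_iff_deriv.2 ⟨fun x => (h.hasDerivAt x).differentiableAt, ?_⟩
    rw [show deriv u = p from funext fun x => (h.hasDerivAt x).deriv]
    exact hK.continuous
  have h1 := hu.contDiffOn.absolutelyContinuousOnInterval (a := 0) (b := l)
  have h2 : AbsolutelyContinuousOnInterval (fun x => (s / z) • p x) 0 l :=
    (hK.lipschitzOnWith.absolutelyContinuousOnInterval).const_smul _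
  refine (congrArg (AbsolutelyContinuousOnInterval · 0 l) (funext fun x => ?_)).mp
    ((c.absolutelyContinuousOnInterval_expo σ (-s) hl).smul (h1.add h2))
  simp only [amplitude, Pi.smul_apply', Pi.add_apply, smul_eq_mul]
  ring

/-- The primitive of the damping in the exponent cancels the diagonal damping term. What remains is
a diagonal term z - σ, a coupling to the opposite amplitude with oscillating coefficient, and a
potential term of order 1/z. -/
theorem ae_hasDerivAt_amplitude (h : c.IsEdgeSolution l z u p) (hz : z ≠ 0) {s : ℝ}
    (hs : s * s = 1) : ∀ᵐ x, x ∈ Icc 0 l →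
      HasDerivAt (c.amplitude σ z u p s) (c.amplitudeDeriv σ z u p s x) x := by
  filter_upwards [h.ae_hasDerivAt, c.ae_hasDerivAt_expo σ (-s)] with x h1 h2 hx
  have h3 := h2.mul ((h.hasDerivAt x).add (((h1 hx).div_const z).const_mul (s : ℂ)))
  refine h3.congr_deriv ?_
  have hs' : (s : ℂ) * s = 1 := by exact_mod_cast hs
  have e1 : c.expo σ (-2 * s) x * c.expo σ s x = c.expo σ (-s) x := by
    rw [← expo_add]; congr 1; ring
  have e2 : c.expo σ (-2 * s) x * c.amplitude σ z u p (-s) x =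
      c.expo σ (-s) x * (u x - s * (p x / z)) := by
    rw [amplitude, neg_neg, ← mul_assoc, e1]; push_cast; ring
  rw [amplitudeDeriv, mul_assoc (c.a x : ℂ), e2, amplitude, q]
  push_cast
  have hs'' : (s : ℂ) ^ 2 = 1 := by rw [sq, hs']
  have e3 : p x = z * (p x / z) := by field_simp
  have e4 : (z ^ 2 + 2 * z * (c.a x : ℂ) - c.b x) * u x / z =
      (z + 2 * c.a x) * u x - c.b x / z * u x := by field_simp
  have e5 : (c.b x : ℂ) / (2 * z) = (c.b x / z) / 2 := by field_simp
  simp only [Pi.add_apply]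
  rw [e4, e5]
  generalize p x / z = w at *
  generalize c.expo σ (-s) x = E
  generalize (c.b x : ℂ) / z = β
  rw [e3]
  linear_combination (-(E * z * w)) * hs''

/-- The distance of the two amplitudes to their initial values. -/
def _root_.EdgeCoeff.deviation (c : EdgeCoeff) (σ z : ℂ) (u p : ℝ → ℂ) (s x : ℝ) : ℝ :=
  ‖c.amplitude σ z u p s x - c.amplitude σ z u p s 0‖ +
    ‖c.amplitude σ z u p (-s) x - c.amplitude σ z u p (-s) 0‖

/-- The size of the two initial amplitudes. -/
def _root_.EdgeCoeff.initialSize (c : EdgeCoeff) (σ z : ℂ) (u p : ℝ → ℂ) (s : ℝ) : ℝ :=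
  ‖c.amplitude σ z u p s 0‖ + ‖c.amplitude σ z u p (-s) 0‖

/-- The subtracted term is the oscillating coupling with the opposite amplitude frozen at its
initial value. It is not small pointwise, but its integral is; the rest is either small or
controlled by the deviation. -/
theorem _root_.EdgeCoeff.norm_amplitudeDeriv_sub_le (c : EdgeCoeff) (σ z : ℂ) (u p : ℝ → ℂ)
    {s x B : ℝ} (hs : |s| = 1) (hB1 : 1 ≤ B) (hB : ‖c.expo σ (-2 * s) x‖ ≤ B) :
    ‖c.amplitudeDeriv σ z u p s x -
        s * c.amplitude σ z u p (-s) 0 * (c.a x * c.expo σ (-2 * s) x)‖ ≤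
      (c.bound * B + (‖z - σ‖ + c.bound * B / ‖z‖)) * c.deviation σ z u p s x +
        (‖z - σ‖ + c.bound * B / ‖z‖) * c.initialSize σ z u p s := by
  have hC := c.bound_nonneg
  have ha := c.norm_ofReal_a_le x
  have hb := c.norm_ofReal_b_le x
  rw [deviation, initialSize]
  have e : c.amplitudeDeriv σ z u p s x -
        s * c.amplitude σ z u p (-s) 0 * (c.a x * c.expo σ (-2 * s) x) =
      s * ((z - σ) * c.amplitude σ z u p s x + c.a x * c.expo σ (-2 * s) x *
          (c.amplitude σ z u p (-s) x - c.amplitude σ z u p (-s) 0) -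
        c.b x / (2 * z) * (c.amplitude σ z u p s x +
          c.expo σ (-2 * s) x * c.amplitude σ z u p (-s) x)) := by
    rw [amplitudeDeriv]; ring
  rw [e, norm_mul, Complex.norm_real, Real.norm_eq_abs, hs, one_mul]
  set α := c.amplitude σ z u p s x
  set β := c.amplitude σ z u p (-s) x
  set α₀ := c.amplitude σ z u p s 0
  set β₀ := c.amplitude σ z u p (-s) 0
  set F := c.expo σ (-2 * s) x
  set D := ‖α - α₀‖ + ‖β - β₀‖ with hD
  set Z := ‖α₀‖ + ‖β₀‖ with hZ
  have hα : ‖α‖ ≤ ‖α - α₀‖ + ‖α₀‖ := by simpa using norm_add_le (α - α₀) α₀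
  have hβ : ‖β‖ ≤ ‖β - β₀‖ + ‖β₀‖ := by simpa using norm_add_le (β - β₀) β₀
  have h1 : ‖(z - σ) * α‖ ≤ ‖z - σ‖ * (D + Z) := by
    rw [norm_mul]
    exact mul_le_mul_of_nonneg_left (by linarith [norm_nonneg (β - β₀), norm_nonneg β₀])
      (norm_nonneg _)
  have h2 : ‖(c.a x : ℂ) * F * (β - β₀)‖ ≤ c.bound * B * D := by
    rw [norm_mul, norm_mul]
    refine mul_le_mul (mul_le_mul ha hB (norm_nonneg _) hC) ?_ (norm_nonneg _) (by positivity)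
    linarith [norm_nonneg (α - α₀)]
  have h3 : ‖α + F * β‖ ≤ B * (D + Z) := by
    refine (norm_add_le _ _).trans ?_
    rw [norm_mul]
    have h4 : ‖F‖ * ‖β‖ ≤ B * ‖β‖ := mul_le_mul_of_nonneg_right hB (norm_nonneg _)
    have h5 : ‖α‖ ≤ B * ‖α‖ := le_mul_of_one_le_left (norm_nonneg _) hB1
    have h6 : B * (‖α‖ + ‖β‖) ≤ B * (D + Z) :=
      mul_le_mul_of_nonneg_left (by linarith) (by linarith)
    linarith
  have h7 : ‖(c.b x : ℂ) / (2 * z)‖ ≤ c.bound / ‖z‖ := by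
    rw [norm_div, norm_mul, Complex.norm_ofNat, mul_comm, ← div_div]
    refine (half_le_self (by positivity)).trans ?_
    exact div_le_div_of_nonneg_right hb (norm_nonneg _)
  have h8 : ‖(c.b x : ℂ) / (2 * z) * (α + F * β)‖ ≤ c.bound / ‖z‖ * (B * (D + Z)) := by
    rw [norm_mul]
    exact mul_le_mul h7 h3 (norm_nonneg _) (by positivity)
  refine ((norm_sub_le _ _).trans (add_le_add ((norm_add_le _ _).trans (add_le_add h1 h2))
    h8)).trans_eq ?_
  ring

theorem norm_amplitude_sub_le (h : c.IsEdgeSolution l z u p) (hz : z ≠ 0) {s B ε x : ℝ}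
    (hs : |s| = 1) (hB1 : 1 ≤ B) (hB : ∀ t ∈ Icc 0 l, ‖c.expo σ (-2 * s) t‖ ≤ B)
    (hx : x ∈ Icc 0 l) (hε : ‖∫ t in (0 : ℝ)..x, (c.a t : ℂ) * c.expo σ (-2 * s) t‖ ≤ ε) :
    ‖c.amplitude σ z u p s x - c.amplitude σ z u p s 0‖ ≤
      (ε + (‖z - σ‖ + c.bound * B / ‖z‖) * l) * c.initialSize σ z u p s +
        (c.bound * B + (‖z - σ‖ + c.bound * B / ‖z‖)) *
          ∫ t in (0 : ℝ)..x, c.deviation σ z u p s t := by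
  have hl : 0 ≤ l := hx.1.trans hx.2
  have hC := c.bound_nonneg
  set η := ‖z - σ‖ + c.bound * B / ‖z‖ with hη
  have hη0 : 0 ≤ η := by positivity
  set k : ℂ := s * c.amplitude σ z u p (-s) 0
  set G : ℝ → ℂ := fun t => (c.a t : ℂ) * c.expo σ (-2 * s) t
  have hcont := h.continuous_amplitude (σ := σ)
  have hdev : Continuous (c.deviation σ z u p s) := by
    have h1 := hcont s
    have h2 := hcont (-s)
    unfold deviation
    fun_prop
  have hm : Measurable (c.amplitudeDeriv σ z u p s) := by
    have h1 := (hcont s).measurable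
    have h2 := (hcont (-s)).measurable
    have h3 := (c.continuous_expo σ (-2 * s)).measurable
    have h4 := c.measurable_ofReal_a
    have h5 := c.measurable_ofReal_b
    unfold amplitudeDeriv
    fun_prop
  have hG : ∀ y, IntervalIntegrable G volume 0 y := fun y =>
    (intervalIntegrable_of_measurable_of_norm_le c.measurable_ofReal_a
        c.norm_ofReal_a_le _ _).mul_continuousOn (c.continuous_expo _ _).continuousOn
  have hsub : ∀ t ∈ Icc 0 l, ‖c.amplitudeDeriv σ z u p s t - k * G t‖ ≤
      (c.bound * B + η) * c.deviation σ z u p s t + η * c.initialSize σ z u p s := fun t ht =>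
    c.norm_amplitudeDeriv_sub_le σ z u p hs hB1 (hB t ht)
  -- A crude bound, needed only to integrate the derivative; it does not enter the final estimate.
  obtain ⟨M, hM⟩ := isCompact_Icc.exists_bound_of_continuousOn (s := Icc 0 l) hdev.continuousOn
  have hbd : ∀ t ∈ Icc 0 l, ‖c.amplitudeDeriv σ z u p s t‖ ≤
      (c.bound * B + η) * M + η * c.initialSize σ z u p s + ‖k‖ * (c.bound * B) := fun t ht => by
    have h1 := hsub t ht
    have h2 : (c.bound * B + η) * c.deviation σ z u p s t ≤ (c.bound * B + η) * M :=
      mul_le_mul_of_nonneg_left ((le_abs_self _).trans (hM t ht)) (by positivity)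
    have h3 : ‖k * G t‖ ≤ ‖k‖ * (c.bound * B) := by
      rw [norm_mul]
      refine mul_le_mul_of_nonneg_left ?_ (norm_nonneg _)
      simp only [G, norm_mul]
      exact mul_le_mul (c.norm_ofReal_a_le t) (hB t ht) (norm_nonneg _) hC
    have h4 : ‖c.amplitudeDeriv σ z u p s t‖ ≤
        ‖c.amplitudeDeriv σ z u p s t - k * G t‖ + ‖k * G t‖ := by
      simpa using norm_add_le (c.amplitudeDeriv σ z u p s t - k * G t) (k * G t)
    linarith
  have hss : s * s = 1 := by rw [← abs_mul_abs_self, hs, one_mul]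
  have hftc := (h.absolutelyContinuousOnInterval_amplitude (σ := σ) hl
    s).sub_eq_integral_of_ae_hasDerivAt hl hm hbd (h.ae_hasDerivAt_amplitude hz hss) hx
  have hint : IntervalIntegrable (c.amplitudeDeriv σ z u p s) volume 0 x := by
    rw [intervalIntegrable_iff_integrableOn_Icc_of_le hx.1]
    refine Measure.integrableOn_of_bounded (M := _) (by simp) hm.aestronglyMeasurable
      (ae_restrict_of_forall_mem measurableSet_Icc fun t ht => hbd t ⟨ht.1, ht.2.trans hx.2⟩)
  have hsplit : ∫ t in (0 : ℝ)..x, c.amplitudeDeriv σ z u p s t =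
      k * (∫ t in (0 : ℝ)..x, G t) +
        ∫ t in (0 : ℝ)..x, (c.amplitudeDeriv σ z u p s t - k * G t) := by
    rw [intervalIntegral.integral_sub hint ((hG x).const_mul k),
      intervalIntegral.integral_const_mul]
    ring
  have hdi : IntervalIntegrable (fun t => (c.bound * B + η) * c.deviation σ z u p s t) volume 0 x :=
    (hdev.const_smul (c.bound * B + η)).intervalIntegrable _ _
  have hR : ‖∫ t in (0 : ℝ)..x, (c.amplitudeDeriv σ z u p s t - k * G t)‖ ≤
      (c.bound * B + η) * (∫ t in (0 : ℝ)..x, c.deviation σ z u p s t) +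
        x * (η * c.initialSize σ z u p s) := by
    refine (intervalIntegral.norm_integral_le_of_norm_le hx.1 (Eventually.of_forall fun t ht =>
      hsub t ⟨ht.1.le, ht.2.trans hx.2⟩) (hdi.add intervalIntegrable_const)).trans_eq ?_
    rw [intervalIntegral.integral_add hdi intervalIntegrable_const,
      intervalIntegral.integral_const_mul, intervalIntegral.integral_const, sub_zero, smul_eq_mul]
  have hZ0 : 0 ≤ c.initialSize σ z u p s := by unfold initialSize; positivity
  have hk : ‖k‖ ≤ c.initialSize σ z u p s := by
    rw [norm_mul, Complex.norm_real, Real.norm_eq_abs, hs, one_mul]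
    exact le_add_of_nonneg_left (norm_nonneg _)
  rw [hftc, hsplit]
  have h1 : ‖k * ∫ t in (0 : ℝ)..x, G t‖ ≤ c.initialSize σ z u p s * ε := by
    rw [norm_mul]
    exact mul_le_mul hk hε (norm_nonneg _) hZ0
  have h2 : x * (η * c.initialSize σ z u p s) ≤ l * (η * c.initialSize σ z u p s) :=
    mul_le_mul_of_nonneg_right hx.2 (by positivity)
  refine ((norm_add_le _ _).trans (add_le_add h1 hR)).trans ?_
  linarith

theorem deviation_le (h : c.IsEdgeSolution l z u p) (hz : z ≠ 0) {B ε x : ℝ}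
    (hB1 : 1 ≤ B) (hB : ∀ s : ℝ, |s| = 1 → ∀ t ∈ Icc 0 l, ‖c.expo σ (-2 * s) t‖ ≤ B)
    (hε : ∀ s : ℝ, |s| = 1 → ∀ x ∈ Icc 0 l,
      ‖∫ t in (0 : ℝ)..x, (c.a t : ℂ) * c.expo σ (-2 * s) t‖ ≤ ε) (hx : x ∈ Icc 0 l) :
    c.deviation σ z u p 1 x ≤
      2 * ((ε + (‖z - σ‖ + c.bound * B / ‖z‖) * l) * c.initialSize σ z u p 1) *
        Real.exp (2 * (c.bound * B + (‖z - σ‖ + c.bound * B / ‖z‖)) * x) := by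
  have hC := c.bound_nonneg
  have hcont := h.continuous_amplitude (σ := σ)
  have hdev : Continuous (c.deviation σ z u p 1) := by
    have h1 := hcont 1
    have h2 := hcont (-1)
    unfold deviation
    fun_prop
  refine le_mul_exp_of_le_add_integral hdev (by positivity) (fun y hy => ?_) hx
  have h1 := h.norm_amplitude_sub_le hz (abs_one) hB1 (hB 1 abs_one) hy (hε 1 abs_one y hy)
  have hn : |(-1 : ℝ)| = 1 := by simp
  have h2 := h.norm_amplitude_sub_le hz hn hB1 (hB (-1) hn) hy (hε (-1) hn y hy)
  -- Both quantities are symmetric under s ↦ -s, so the estimates for the two signs add up to a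
  -- closed inequality.
  have e1 : c.deviation σ z u p (-1) = c.deviation σ z u p 1 := by
    funext t; simp only [deviation, neg_neg]; ring
  have e2 : c.initialSize σ z u p (-1) = c.initialSize σ z u p 1 := by
    simp only [initialSize, neg_neg]; ring
  rw [e1, e2] at h2
  have e3 : c.deviation σ z u p 1 y = ‖c.amplitude σ z u p 1 y - c.amplitude σ z u p 1 0‖ +
    ‖c.amplitude σ z u p (-1) y - c.amplitude σ z u p (-1) 0‖ := rfl
  rw [e3]
  linarith

end IsEdgeSolution

end EdgeCoeff

/-! ### High frequency limit of the transfer matrix -/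

namespace EdgeCoeff

theorem tendsto_norm_add_two_pi_I_mul {ι : Type*} {F : Filter ι} {μ : ι → ℂ} {μ₀ : ℂ}
    (hμ : Tendsto μ F (𝓝 μ₀)) {n : ι → ℕ} (hn : Tendsto n F atTop) :
    Tendsto (fun i => ‖μ i + 2 * Real.pi * Complex.I * n i‖) F atTop := by
  have h1 : Tendsto (fun i => 2 * Real.pi * (n i : ℝ)) F atTop :=
    (tendsto_natCast_atTop_atTop.comp hn).const_mul_atTop (by positivity)
  have h2 : Tendsto (fun i => (μ i).im) F (𝓝 μ₀.im) := (Complex.continuous_im.tendsto _).comp hμ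
  refine tendsto_atTop_mono (fun i => ?_) (h2.add_atTop h1)
  refine le_trans ?_ (Complex.im_le_norm _)
  simp

variable {c : EdgeCoeff} {l : ℝ} {ι : Type*} {F : Filter ι} {μ : ι → ℂ} {μ₀ : ℂ} {n : ι → ℕ}
  {u p : ι → ℝ → ℂ} {u₀ w₀ : ℂ}

theorem amplitude_zero {σ z : ℂ} {u p : ℝ → ℂ} (hz : z ≠ 0) (hu : u 0 = u₀) (hp : p 0 = z * w₀)
    (s : ℝ) : c.amplitude σ z u p s 0 = u₀ + s * w₀ := by
  simp [amplitude, expo, primitive, hu, hp, hz]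

/-- The reference exponent σ = μ₀ + 2πin has fixed real part and differs from z by μ - μ₀ → 0. A
general filter lets μ and n vary jointly, which later gives locally uniform convergence. -/
theorem tendsto_deviation (hl : 0 ≤ l) (hμ : Tendsto μ F (𝓝 μ₀)) (hn : Tendsto n F atTop)
    (h : ∀ i, c.IsEdgeSolution l (μ i + 2 * Real.pi * Complex.I * n i) (u i) (p i))
    (hu : ∀ i, u i 0 = u₀) (hp : ∀ i, p i 0 = (μ i + 2 * Real.pi * Complex.I * n i) * w₀) :
    Tendsto (fun i => c.deviation (μ₀ + 2 * Real.pi * Complex.I * n i)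
      (μ i + 2 * Real.pi * Complex.I * n i) (u i) (p i) 1 l) F (𝓝 0) := by
  have hC := c.bound_nonneg
  set B := Real.exp (2 * ((|μ₀.re| + c.bound) * l)) with hBdef
  have hB1 : 1 ≤ B := Real.one_le_exp (by positivity)
  set Z := ‖u₀ + w₀‖ + ‖u₀ - w₀‖ with hZ
  set K := 2 * ((1 + l) * Z) * Real.exp (2 * (c.bound * B + 1) * l) with hK
  have hK0 : 0 ≤ K := by positivity
  have hnorm := tendsto_norm_add_two_pi_I_mul hμ hn
  have hη : Tendsto (fun i => ‖μ i - μ₀‖ +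
      c.bound * B / ‖μ i + 2 * Real.pi * Complex.I * n i‖) F (𝓝 0) := by
    simpa using (tendsto_iff_norm_sub_tendsto_zero.1 hμ).add (hnorm.const_div_atTop (c.bound * B))
  rw [Metric.tendsto_nhds]
  intro δ hδ
  -- Once η ≤ ε in the prefactor and η ≤ 1 in the exponent, the Grönwall bound is at most ε * K < δ.
  set ε := δ / (K + 1) with hε
  have hε0 : 0 < ε := by positivity
  filter_upwards [hη.eventually_le_const hε0, hη.eventually_le_const one_pos,
    hnorm.eventually_gt_atTop 0,
    hn.eventually (c.eventually_norm_integral_expo_le μ₀ (s := 2) (by norm_num) l hε0),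
    hn.eventually (c.eventually_norm_integral_expo_le μ₀ (s := -2) (by norm_num) l hε0)]
    with i h1 h2 h3 h4 h5
  have hz : μ i + 2 * Real.pi * Complex.I * n i ≠ 0 := norm_pos_iff.1 h3
  have hcases : ∀ s : ℝ, |s| = 1 → s = 1 ∨ s = -1 := fun s hs =>
    (abs_eq zero_le_one).1 hs
  have hdev := (h i).deviation_le (σ := μ₀ + 2 * Real.pi * Complex.I * n i) hz (B := B) (ε := ε)
    (x := l) hB1 (fun s hs t ht => by
      have := c.norm_expo_le (μ₀ + 2 * Real.pi * Complex.I * n i) (s := -2 * s) ht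
      simpa [abs_mul, hs, hBdef] using this)
    (fun s hs x hx => by
      rcases hcases s hs with rfl | rfl
      · simpa using h5 x hx
      · simpa using h4 x hx) ⟨hl, le_rfl⟩
  have hinit : c.initialSize (μ₀ + 2 * Real.pi * Complex.I * n i)
      (μ i + 2 * Real.pi * Complex.I * n i) (u i) (p i) 1 = Z := by
    simp [initialSize, amplitude_zero hz (hu i) (hp i), hZ, sub_eq_add_neg]
  rw [hinit, add_sub_add_right_eq_sub] at hdev
  set η := ‖μ i - μ₀‖ + c.bound * B / ‖μ i + 2 * Real.pi * Complex.I * n i‖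
  have hη0 : 0 ≤ η := by positivity
  have hdev0 : 0 ≤ c.deviation (μ₀ + 2 * Real.pi * Complex.I * n i)
      (μ i + 2 * Real.pi * Complex.I * n i) (u i) (p i) 1 l := by unfold deviation; positivity
  rw [dist_zero_right, Real.norm_of_nonneg hdev0]
  refine hdev.trans_lt ?_
  have h6 : 2 * ((ε + η * l) * Z) * Real.exp (2 * (c.bound * B + η) * l) ≤
      2 * ((ε + ε * l) * Z) * Real.exp (2 * (c.bound * B + 1) * l) := by gcongr
  have h7 : 2 * ((ε + ε * l) * Z) * Real.exp (2 * (c.bound * B + 1) * l) = ε * K := by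
    rw [hK]; ring
  refine (h6.trans_eq h7).trans_lt ?_
  rw [hε, div_mul_eq_mul_div, div_lt_iff₀ (by positivity)]
  nlinarith

theorem tendsto_expo (hrec : Tendsto (fun i => Complex.exp (2 * Real.pi * Complex.I * n i * l)) F
    (𝓝 1)) {s : ℝ} (hs : |s| = 1) :
    Tendsto (fun i => c.expo (μ₀ + 2 * Real.pi * Complex.I * n i) s l) F
      (𝓝 (Complex.exp (s * (μ₀ * l + c.primitive l)))) := by
  have e : ∀ i, c.expo (μ₀ + 2 * Real.pi * Complex.I * n i) s l =
      Complex.exp (s * (μ₀ * l + c.primitive l)) *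
        Complex.exp (s * (2 * Real.pi * Complex.I * n i * l)) := fun i => by
    rw [expo, ← Complex.exp_add]; ring_nf
  simp only [e]
  have key : Tendsto (fun i => Complex.exp (s * (2 * Real.pi * Complex.I * n i * l))) F (𝓝 1) := by
    rcases (abs_eq zero_le_one).1 hs with rfl | rfl
    · simpa using hrec
    · simpa [Complex.exp_neg] using hrec.inv₀ one_ne_zero
  simpa using key.const_mul (Complex.exp (s * (μ₀ * l + c.primitive l)))

/-- High frequency asymptotics of the solutions on an edge. -/
theorem tendsto_edgeSolution (hl : 0 ≤ l) (hμ : Tendsto μ F (𝓝 μ₀)) (hn : Tendsto n F atTop)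
    (hrec : Tendsto (fun i => Complex.exp (2 * Real.pi * Complex.I * n i * l)) F (𝓝 1))
    (h : ∀ i, c.IsEdgeSolution l (μ i + 2 * Real.pi * Complex.I * n i) (u i) (p i))
    (hu : ∀ i, u i 0 = u₀) (hp : ∀ i, p i 0 = (μ i + 2 * Real.pi * Complex.I * n i) * w₀) :
    Tendsto (fun i => u i l) F (𝓝 (Complex.cosh (μ₀ * l + c.primitive l) * u₀ +
      Complex.sinh (μ₀ * l + c.primitive l) * w₀)) ∧
    Tendsto (fun i => p i l / (μ i + 2 * Real.pi * Complex.I * n i)) F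
      (𝓝 (Complex.sinh (μ₀ * l + c.primitive l) * u₀ +
        Complex.cosh (μ₀ * l + c.primitive l) * w₀)) := by
  have hdev := tendsto_deviation hl hμ hn h hu hp
  have hz : ∀ᶠ i in F, μ i + 2 * Real.pi * Complex.I * n i ≠ 0 :=
    ((tendsto_norm_add_two_pi_I_mul hμ hn).eventually_gt_atTop 0).mono fun i => norm_pos_iff.1
  have hamp : ∀ s : ℝ, |s| = 1 → Tendsto (fun i => c.amplitude (μ₀ + 2 * Real.pi * Complex.I * n i)
      (μ i + 2 * Real.pi * Complex.I * n i) (u i) (p i) s l) F (𝓝 (u₀ + s * w₀)) := fun s hs => by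
    rw [tendsto_iff_norm_sub_tendsto_zero]
    refine squeeze_zero' (Eventually.of_forall fun _ => norm_nonneg _) ?_ hdev
    filter_upwards [hz] with i hi
    rw [← amplitude_zero (c := c) (σ := μ₀ + 2 * Real.pi * Complex.I * n i) hi (hu i) (hp i) s]
    rcases (abs_eq zero_le_one).1 hs with rfl | rfl
    · exact le_add_of_nonneg_right (norm_nonneg _)
    · exact le_add_of_nonneg_left (norm_nonneg _)
  -- Undoing the normalisation of the amplitudes gives u ± p/z; half the sum and half the difference
  -- produce the hyperbolic functions.
  have hmain : ∀ s : ℝ, |s| = 1 → Tendsto (fun i => u i l +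
      s * (p i l / (μ i + 2 * Real.pi * Complex.I * n i))) F
        (𝓝 (Complex.exp (s * (μ₀ * l + c.primitive l)) * (u₀ + s * w₀))) := fun s hs => by
    refine ((tendsto_expo hrec hs).mul (hamp s hs)).congr fun i => ?_
    rw [amplitude, ← mul_assoc, mul_comm (c.expo _ s l), expo_neg_mul, one_mul]
  have h1 := hmain 1 (by simp)
  have h2 := hmain (-1) (by simp)
  constructor
  · convert (h1.add h2).div_const 2 using 2
    · push_cast; ring
    · rw [Complex.cosh, Complex.sinh]; push_cast; simp only [neg_mul, one_mul]; ring
  · convert (h1.sub h2).div_const 2 using 2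
    · push_cast; ring
    · rw [Complex.cosh, Complex.sinh]; push_cast; simp only [neg_mul, one_mul]; ring

end EdgeCoeff

/-! ### Bounded representatives and regularity of edge solutions -/

/-- A measurable representative is set to zero wherever it exceeds the essential supremum. -/
theorem exists_measurable_bounded_ae_eq {f : ℝ → ℝ} {μ : Measure ℝ} (hf : MemLp f ⊤ μ) :
    ∃ g : ℝ → ℝ, Measurable g ∧ (∃ C, ∀ t, |g t| ≤ C) ∧ g =ᵐ[μ] f := by
  obtain ⟨hm, hb⟩ := hf
  set C := (eLpNorm f ⊤ μ).toReal with hC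
  set f' := hm.mk f
  have hf' : Measurable f' := hm.stronglyMeasurable_mk.measurable
  refine ⟨{x | |f' x| ≤ C}.indicator f',
    hf'.indicator (measurableSet_le hf'.abs measurable_const), ⟨C, fun t => ?_⟩, ?_⟩
  · by_cases ht : t ∈ {x | |f' x| ≤ C}
    · rwa [indicator_of_mem ht]
    · rw [indicator_of_notMem ht, abs_zero]
      exact ENNReal.toReal_nonneg
  · filter_upwards [hm.ae_eq_mk, ae_le_eLpNormEssSup (f := f) (μ := μ)] with t h1 h2
    have ht : t ∈ {x | |f' x| ≤ C} := by
      change |hm.mk f t| ≤ C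
      rw [← h1, ← Real.norm_eq_abs, ← toReal_enorm, hC]
      exact ENNReal.toReal_mono hb.ne (by rwa [eLpNorm_exponent_top])
    rw [indicator_of_mem ht]
    exact h1.symm

theorem DampedGraph.exists_edgeCoeff {V E : Type*} (Γ : DampedGraph V E) (e : E) :
    ∃ c : EdgeCoeff, ∀ᵐ x, x ∈ Icc 0 (Γ.len e) →
      c.a x = Γ.damping e x ∧ c.b x = Γ.potential e x := by
  obtain ⟨a, ha, ⟨A, hA⟩, ha'⟩ := exists_measurable_bounded_ae_eq (Γ.damping_bdd e)
  obtain ⟨b, hb, ⟨B, hB⟩, hb'⟩ := exists_measurable_bounded_ae_eq (Γ.potential_bdd e)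
  refine ⟨⟨a, b, max A B, ha, hb, fun t => (hA t).trans (le_max_left _ _),
    fun t => (hB t).trans (le_max_right _ _)⟩, ?_⟩
  filter_upwards [(ae_restrict_iff' measurableSet_Icc).1 ha',
    (ae_restrict_iff' measurableSet_Icc).1 hb'] with x h1 h2 hx
  exact ⟨h1 hx, h2 hx⟩

namespace EdgeCoeff.IsEdgeSolution

variable {c : EdgeCoeff} {l : ℝ} {z : ℂ} {u p : ℝ → ℂ}

theorem const_mul (h : c.IsEdgeSolution l z u p) (α : ℂ) :
    c.IsEdgeSolution l z (fun x => α * u x) (fun x => α * p x) := by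
  simpa using h.linearCombination h α 0

theorem edgeDeriv_eq (h : c.IsEdgeSolution l z u p) (hl : 0 < l) {x : ℝ} (hx : x ∈ Icc 0 l) :
    edgeDeriv l u x = p x :=
  (h.hasDerivAt x).hasDerivWithinAt.derivWithin (uniqueDiffOn_Icc hl x hx)

theorem ae_edgeDeriv₂_eq (h : c.IsEdgeSolution l z u p) (hl : 0 < l) :
    ∀ᵐ x ∂(volume.restrict (Icc 0 l)), edgeDeriv₂ l u x = c.q z x * u x := by
  -- The one-sided derivative agrees with p on [0, l] only, so differentiating it again requires an
  -- interior point.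
  rw [Measure.restrict_congr_set Ioo_ae_eq_Icc.symm, ae_restrict_iff' measurableSet_Ioo]
  filter_upwards [h.ae_hasDerivAt] with x h1 hx
  have hev : edgeDeriv l u =ᶠ[𝓝 x] p := by
    filter_upwards [Ioo_mem_nhds hx.1 hx.2] with y hy
    exact h.edgeDeriv_eq hl (Ioo_subset_Icc_self hy)
  rw [edgeDeriv₂, hev.deriv_eq]
  exact (h1 (Ioo_subset_Icc_self hx)).deriv

theorem isW22 (h : c.IsEdgeSolution l z u p) (hl : 0 < l) : IsW22 l u where
  differentiableOn x _ := (h.hasDerivAt x).differentiableAt.differentiableWithinAt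
  absolutelyContinuous := by
    obtain ⟨K, hK⟩ := h.lipschitz
    refine LipschitzOnWith.absolutelyContinuousOnInterval (K := K) fun x hx y hy => ?_
    rw [uIcc_of_le hl.le] at hx hy
    rw [h.edgeDeriv_eq hl hx, h.edgeDeriv_eq hl hy]
    exact hK x y
  memLp := by
    have hu : Continuous u := continuous_iff_continuousAt.2 fun x => (h.hasDerivAt x).continuousAt
    obtain ⟨M, hM⟩ := isCompact_Icc.exists_bound_of_continuousOn (s := Icc 0 l) hu.continuousOn
    refine (memLp_congr_ae (h.ae_edgeDeriv₂_eq hl)).2 (MemLp.of_bound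
      (C := (‖z‖ ^ 2 + 2 * ‖z‖ * c.bound + c.bound) * M)
      ((c.measurable_q z).mul hu.measurable).aestronglyMeasurable
      (ae_restrict_of_forall_mem measurableSet_Icc fun x hx => ?_))
    rw [norm_mul]
    exact mul_le_mul (c.norm_q_le z x) (hM x hx) (norm_nonneg _)
      ((norm_nonneg _).trans (c.norm_q_le z x))

end EdgeCoeff.IsEdgeSolution

/-! ### The secular determinant -/

namespace DampedGraph

variable {V E : Type*} [Fintype E] (Γ : DampedGraph V E)

open Classical in
/-- The coupling conditions as a linear map. If `u e` has the value `x (src e)` and the scaled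
derivative `x e` at the start of the edge `e`, and the matrix `τ e` maps these two numbers to the
corresponding numbers at the end of `e`, then the component at `v` is minus the sum of the outward
derivatives and the component at `e` is the jump of the values at the end of `e`. The last term at
`v` makes the map injective on the isolated vertices. -/
def couplingMap (τ : E → Matrix (Fin 2) (Fin 2) ℂ) : (V ⊕ E → ℂ) →ₗ[ℂ] (V ⊕ E → ℂ) where
  toFun x := Sum.elim
    (fun v => ∑ e, ((if Γ.tgt e = v then
        τ e 1 0 * x (Sum.inl (Γ.src e)) + τ e 1 1 * x (Sum.inr e) else 0) -
        (if Γ.src e = v then x (Sum.inr e) else 0)) +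
      if ∃ e, Γ.src e = v ∨ Γ.tgt e = v then 0 else x (Sum.inl v))
    (fun e => τ e 0 0 * x (Sum.inl (Γ.src e)) + τ e 0 1 * x (Sum.inr e) - x (Sum.inl (Γ.tgt e)))
  map_add' x y := by
    funext i
    rcases i with v | e
    · simp only [Sum.elim_inl, Pi.add_apply]
      rw [add_add_add_comm, ← Finset.sum_add_distrib]
      congr 1
      · refine Finset.sum_congr rfl fun e _ => ?_
        split_ifs <;> ring
      · split_ifs <;> ring
    · simp only [Sum.elim_inr, Pi.add_apply]
      ring
  map_smul' k x := by
    funext i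
    rcases i with v | e
    · simp only [Sum.elim_inl, Pi.smul_apply, smul_eq_mul, RingHom.id_apply]
      rw [mul_add, Finset.mul_sum]
      congr 1
      · refine Finset.sum_congr rfl fun e _ => ?_
        split_ifs <;> ring
      · split_ifs <;> ring
    · simp only [Sum.elim_inr, Pi.smul_apply, smul_eq_mul, RingHom.id_apply]
      ring

open Classical in
theorem couplingMap_inl (τ : E → Matrix (Fin 2) (Fin 2) ℂ) (x : V ⊕ E → ℂ) (v : V) :
    Γ.couplingMap τ x (Sum.inl v) = ∑ e, ((if Γ.tgt e = v then
        τ e 1 0 * x (Sum.inl (Γ.src e)) + τ e 1 1 * x (Sum.inr e) else 0) -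
        (if Γ.src e = v then x (Sum.inr e) else 0)) +
      if ∃ e, Γ.src e = v ∨ Γ.tgt e = v then 0 else x (Sum.inl v) := rfl

theorem couplingMap_inr (τ : E → Matrix (Fin 2) (Fin 2) ℂ) (x : V ⊕ E → ℂ) (e : E) :
    Γ.couplingMap τ x (Sum.inr e) =
      τ e 0 0 * x (Sum.inl (Γ.src e)) + τ e 0 1 * x (Sum.inr e) - x (Sum.inl (Γ.tgt e)) := rfl

theorem eq_zero_of_couplingMap_eq_zero {τ : E → Matrix (Fin 2) (Fin 2) ℂ} {x : V ⊕ E → ℂ}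
    (hx : Γ.couplingMap τ x = 0) {v : V} (hv : ¬ ∃ e, Γ.src e = v ∨ Γ.tgt e = v) :
    x (Sum.inl v) = 0 := by
  have h := congrFun hx (Sum.inl v)
  rw [couplingMap_inl, if_neg hv, Finset.sum_eq_zero, zero_add] at h
  · exact h
  · intro e _
    rw [if_neg fun h => hv ⟨e, Or.inr h⟩, if_neg fun h => hv ⟨e, Or.inl h⟩, sub_zero]

open Classical in
theorem sum_eq_zero_of_couplingMap_eq_zero {τ : E → Matrix (Fin 2) (Fin 2) ℂ} {x : V ⊕ E → ℂ}
    (hx : Γ.couplingMap τ x = 0) (v : V) : ∑ e, ((if Γ.tgt e = v then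
      τ e 1 0 * x (Sum.inl (Γ.src e)) + τ e 1 1 * x (Sum.inr e) else 0) -
        (if Γ.src e = v then x (Sum.inr e) else 0)) = 0 := by
  have h := congrFun hx (Sum.inl v)
  have h' : (if ∃ e, Γ.src e = v ∨ Γ.tgt e = v then 0 else x (Sum.inl v)) = 0 := by
    split_ifs with hv
    · rfl
    · exact Γ.eq_zero_of_couplingMap_eq_zero hx hv
  rwa [couplingMap_inl, h', add_zero] at h

theorem eq_of_couplingMap_eq_zero {τ : E → Matrix (Fin 2) (Fin 2) ℂ} {x : V ⊕ E → ℂ}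
    (hx : Γ.couplingMap τ x = 0) (e : E) :
    τ e 0 0 * x (Sum.inl (Γ.src e)) + τ e 0 1 * x (Sum.inr e) = x (Sum.inl (Γ.tgt e)) := by
  have h := congrFun hx (Sum.inr e)
  rw [couplingMap_inr] at h
  exact sub_eq_zero.1 h

open Classical in
/-- The secular determinant. -/
def secularDet [Fintype V] (τ : E → Matrix (Fin 2) (Fin 2) ℂ) : ℂ :=
  (LinearMap.toMatrix' (Γ.couplingMap τ)).det

theorem secularDet_eq_zero_iff [Fintype V] (τ : E → Matrix (Fin 2) (Fin 2) ℂ) :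
    Γ.secularDet τ = 0 ↔ ∃ x, x ≠ 0 ∧ Γ.couplingMap τ x = 0 := by
  classical
  rw [secularDet, ← Matrix.exists_mulVec_eq_zero_iff]
  simp only [LinearMap.toMatrix'_mulVec]

theorem continuous_secularDet [Fintype V] : Continuous Γ.secularDet := by
  classical
  refine Continuous.matrix_det (continuous_pi fun i => continuous_pi fun j => ?_)
  simp only [LinearMap.toMatrix'_apply]
  rcases i with v | e
  · simp only [couplingMap_inl]
    refine (continuous_finsetSum _ fun e _ => ?_).add continuous_const
    refine Continuous.sub ?_ continuous_const
    split_ifs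
    · fun_prop
    · exact continuous_const
  · simp only [couplingMap_inr]
    fun_prop

theorem differentiableAt_secularDet [Fintype V] {τ : ℂ → E → Matrix (Fin 2) (Fin 2) ℂ} {z : ℂ}
    (hτ : ∀ e i j, DifferentiableAt ℂ (fun z => τ z e i j) z) :
    DifferentiableAt ℂ (fun z => Γ.secularDet (τ z)) z := by
  classical
  simp only [secularDet, Matrix.det_apply']
  refine DifferentiableAt.fun_sum fun σ _ =>
    (DifferentiableAt.fun_finsetProd fun j _ => ?_).const_mul _
  simp only [LinearMap.toMatrix'_apply]
  rcases σ j with v | e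
  · simp only [couplingMap_inl]
    refine (DifferentiableAt.fun_sum fun e _ => ?_).add (differentiableAt_const _)
    refine DifferentiableAt.sub ?_ (differentiableAt_const _)
    split_ifs
    · exact ((hτ e 1 0).mul_const _).add ((hτ e 1 1).mul_const _)
    · exact differentiableAt_const _
  · simp only [couplingMap_inr]
    exact (((hτ e 0 0).mul_const _).add ((hτ e 0 1).mul_const _)).sub_const _

/-- A zero of the secular determinant is an eigenvalue. -/
theorem isEigenvalue_of_secularDet_eq_zero [Fintype V] {c : E → EdgeCoeff}
    (hc : ∀ e, ∀ᵐ x, x ∈ Icc 0 (Γ.len e) →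
      (c e).a x = Γ.damping e x ∧ (c e).b x = Γ.potential e x)
    {z : ℂ} (hz : z ≠ 0) {u₁ p₁ u₂ p₂ : E → ℝ → ℂ}
    (h₁ : ∀ e, (c e).IsEdgeSolution (Γ.len e) z (u₁ e) (p₁ e) ∧ u₁ e 0 = 1 ∧ p₁ e 0 = 0)
    (h₂ : ∀ e, (c e).IsEdgeSolution (Γ.len e) z (u₂ e) (p₂ e) ∧ u₂ e 0 = 0 ∧ p₂ e 0 = z)
    (hdet : Γ.secularDet (fun e => !![u₁ e (Γ.len e), u₂ e (Γ.len e);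
      p₁ e (Γ.len e) / z, p₂ e (Γ.len e) / z]) = 0) : Γ.IsEigenvalue z := by
  classical
  obtain ⟨x, hx0, hx⟩ := (Γ.secularDet_eq_zero_iff _).1 hdet
  set φ : V → ℂ := fun v => x (Sum.inl v) with hφ
  set w : E → ℂ := fun e => x (Sum.inr e) with hw
  set u : E → ℝ → ℂ := fun e t => φ (Γ.src e) * u₁ e t + w e * u₂ e t with hu
  set p : E → ℝ → ℂ := fun e t => φ (Γ.src e) * p₁ e t + w e * p₂ e t with hp
  have hsol : ∀ e, (c e).IsEdgeSolution (Γ.len e) z (u e) (p e) := fun e =>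
    (h₁ e).1.linearCombination (h₂ e).1 _ _
  have hl := Γ.len_pos
  have h0 : ∀ e, (0 : ℝ) ∈ Icc 0 (Γ.len e) := fun e => ⟨le_rfl, (hl e).le⟩
  have h1 : ∀ e, Γ.len e ∈ Icc 0 (Γ.len e) := fun e => ⟨(hl e).le, le_rfl⟩
  have hu0 : ∀ e, u e 0 = φ (Γ.src e) := fun e => by simp [hu, (h₁ e).2.1, (h₂ e).2.1]
  have hp0 : ∀ e, p e 0 = z * w e := fun e => by
    simp [hp, (h₁ e).2.2, (h₂ e).2.2, mul_comm]
  have hul : ∀ e, u e (Γ.len e) = φ (Γ.tgt e) := fun e => by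
    have h := Γ.eq_of_couplingMap_eq_zero hx e
    simp only [Matrix.of_apply, Matrix.cons_val', Matrix.cons_val_zero, Matrix.cons_val_one,
      Matrix.cons_val_fin_one] at h
    simp only [hu, hφ, hw, ← h]
    ring
  have hiso : ∀ v, (¬ ∃ e, Γ.src e = v ∨ Γ.tgt e = v) → φ v = 0 := fun v hv =>
    Γ.eq_zero_of_couplingMap_eq_zero hx hv
  have hkir : ∀ v, ∑ e, ((if Γ.src e = v then p e 0 else 0) +
      (if Γ.tgt e = v then -p e (Γ.len e) else 0)) = 0 := fun v => by
    have h := Γ.sum_eq_zero_of_couplingMap_eq_zero hx v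
    simp only [Matrix.of_apply, Matrix.cons_val', Matrix.cons_val_zero, Matrix.cons_val_one,
      Matrix.cons_val_fin_one] at h
    have hpl : ∀ e, p e (Γ.len e) = z * (p₁ e (Γ.len e) / z * φ (Γ.src e) +
        p₂ e (Γ.len e) / z * w e) := fun e => by simp only [hp]; field_simp
    -- The derivative entries are scaled by 1/z and the coupling map has the opposite sign, whence
    -- the factor -z.
    have e1 : ∑ e, ((if Γ.src e = v then p e 0 else 0) +
        (if Γ.tgt e = v then -p e (Γ.len e) else 0)) =
        -z * ∑ e, ((if Γ.tgt e = v then p₁ e (Γ.len e) / z * φ (Γ.src e) +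
          p₂ e (Γ.len e) / z * w e else 0) - (if Γ.src e = v then w e else 0)) := by
      rw [Finset.mul_sum]
      refine Finset.sum_congr rfl fun e _ => ?_
      rw [hp0, hpl]
      split_ifs <;> ring
    rw [e1]
    exact mul_eq_zero_of_right _ h
  -- Used with k = 1 and k = z, for the two components u and zu of the eigenfunction.
  have hcoup : ∀ k : ℂ, Γ.StandardCoupling fun e t => k * u e t := fun k => by
    refine ⟨⟨fun v => k * φ v, fun e => ⟨congrArg (k * ·) (hu0 e), congrArg (k * ·) (hul e)⟩⟩,
      fun v => ?_⟩
    have e1 : Γ.outwardDerivSum (fun e t => k * u e t) v = k * ∑ e,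
        ((if Γ.src e = v then p e 0 else 0) + (if Γ.tgt e = v then -p e (Γ.len e) else 0)) := by
      rw [outwardDerivSum, Finset.mul_sum]
      refine Finset.sum_congr rfl fun e _ => ?_
      rw [((hsol e).const_mul k).edgeDeriv_eq (hl e) (h0 e),
        ((hsol e).const_mul k).edgeDeriv_eq (hl e) (h1 e)]
      split_ifs <;> ring
    rw [e1, hkir v, mul_zero]
  refine ⟨(u, fun e t => z * u e t), ⟨fun e => ⟨(hsol e).isW22 (hl e),
    ((hsol e).const_mul z).isW22 (hl e)⟩, by simpa using hcoup 1, hcoup z⟩, ?_, fun e => ?_⟩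
  -- If u vanishes on all edges, so do its vertex values and, because z ≠ 0, the scaled initial
  -- derivatives; isolated vertices are covered by the extra term of the coupling map.
  · by_contra! hcon
    have hzero : ∀ e, ∀ t ∈ Icc 0 (Γ.len e), u e t = 0 := fun e t ht => (hcon e t ht).1
    have hφ0 : ∀ v, φ v = 0 := fun v => by
      by_cases hv : ∃ e, Γ.src e = v ∨ Γ.tgt e = v
      · obtain ⟨e, rfl | rfl⟩ := hv
        · rw [← hu0, hzero e _ (h0 e)]
        · rw [← hul, hzero e _ (h1 e)]
      · exact hiso v hv
    have hw0 : ∀ e, w e = 0 := fun e => by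
      have h2 : edgeDeriv (Γ.len e) (u e) 0 = 0 := by
        rw [edgeDeriv, derivWithin_congr (f := fun _ => 0) (hzero e) (hzero e 0 (h0 e))]
        simp
      rw [(hsol e).edgeDeriv_eq (hl e) (h0 e), hp0] at h2
      exact (mul_eq_zero.1 h2).resolve_left hz
    refine hx0 (funext fun i => ?_)
    rcases i with v | e
    · exact hφ0 v
    · exact hw0 e
  · filter_upwards [(hsol e).ae_edgeDeriv₂_eq (hl e), ae_restrict_of_ae (hc e),
      ae_restrict_mem measurableSet_Icc] with t h2 h3 h4
    refine ⟨rfl, ?_⟩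
    obtain ⟨h5, h6⟩ := h3 h4
    simp only [H, h2, EdgeCoeff.q, h5, h6]
    ring

end DampedGraph

/-! ### The limit determinant: nonvanishing, and its zero from a loop -/

/-- The transfer matrix `(u, u' / z) ↦ (u, u' / z)` of the equation `u'' = z ^ 2 u` over an edge of
length `l`, with `θ = z l`. -/
def hyperbolicMatrix (θ : ℂ) : Matrix (Fin 2) (Fin 2) ℂ :=
  !![Complex.cosh θ, Complex.sinh θ; Complex.sinh θ, Complex.cosh θ]

theorem hyperbolicMatrix_zero : hyperbolicMatrix 0 = 1 := by
  rw [hyperbolicMatrix, Matrix.one_fin_two]; simp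

theorem differentiable_hyperbolicMatrix_apply (i j : Fin 2) :
    Differentiable ℂ fun θ => hyperbolicMatrix θ i j := by
  fin_cases i <;> fin_cases j <;> simp [hyperbolicMatrix]

/-- For the solution of y'' = y on [0, θ] with y(0) = u and y'(0) = w, the flux Re(ȳ y') grows by ∫
(|y|² + |y'|²). The proof replaces this integral by an explicit sum of squares with positive
coefficients. -/
theorem energy_flux_nonneg {θ : ℝ} (hθ : 0 < θ) (u w : ℂ) :
    0 ≤ ((starRingEnd ℂ) (Complex.cosh θ * u + Complex.sinh θ * w) *
        (Complex.sinh θ * u + Complex.cosh θ * w) - (starRingEnd ℂ) u * w).re ∧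
      (((starRingEnd ℂ) (Complex.cosh θ * u + Complex.sinh θ * w) *
        (Complex.sinh θ * u + Complex.cosh θ * w) - (starRingEnd ℂ) u * w).re = 0 →
          u = 0 ∧ w = 0) := by
  have hS : 0 < Real.sinh θ := Real.sinh_pos_iff.2 hθ
  have hCS : 0 < Real.cosh θ - Real.sinh θ := sub_pos.2 (Real.sinh_lt_cosh θ)
  have h1 := Real.cosh_sq θ
  have e : ((starRingEnd ℂ) (Complex.cosh θ * u + Complex.sinh θ * w) *
        (Complex.sinh θ * u + Complex.cosh θ * w) - (starRingEnd ℂ) u * w).re =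
      Real.sinh θ * (Real.cosh θ - Real.sinh θ) * (u.re ^ 2 + u.im ^ 2 + w.re ^ 2 + w.im ^ 2) +
        Real.sinh θ ^ 2 * ((u.re + w.re) ^ 2 + (u.im + w.im) ^ 2) := by
    rw [← Complex.ofReal_cosh, ← Complex.ofReal_sinh]
    generalize Real.sinh θ = S at *
    generalize Real.cosh θ = C at *
    simp only [map_add, map_mul, Complex.conj_ofReal, Complex.sub_re, Complex.mul_re,
      Complex.add_re, Complex.add_im, Complex.mul_im, Complex.conj_re, Complex.conj_im,
      Complex.ofReal_re, Complex.ofReal_im]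
    linear_combination (u.re * w.re + u.im * w.im) * h1
  have hpos : 0 < Real.sinh θ * (Real.cosh θ - Real.sinh θ) := mul_pos hS hCS
  have h2 : 0 ≤ Real.sinh θ ^ 2 * ((u.re + w.re) ^ 2 + (u.im + w.im) ^ 2) := by positivity
  rw [e]
  refine ⟨by positivity, fun h0 => ?_⟩
  have h3 : u.re ^ 2 + u.im ^ 2 + w.re ^ 2 + w.im ^ 2 = 0 := by
    by_contra hne
    have : 0 < u.re ^ 2 + u.im ^ 2 + w.re ^ 2 + w.im ^ 2 :=
      lt_of_le_of_ne (by positivity) (Ne.symm hne)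
    have := mul_pos hpos this
    linarith
  have h4 := sq_nonneg u.re
  have h5 := sq_nonneg u.im
  have h6 := sq_nonneg w.re
  have h7 := sq_nonneg w.im
  refine ⟨Complex.ext ?_ ?_, Complex.ext ?_ ?_⟩ <;>
    exact pow_eq_zero_iff two_ne_zero |>.1 (by linarith)

namespace DampedGraph

variable {V E : Type*} [Fintype V] [Fintype E] (Γ : DampedGraph V E)

/-- By the coupling conditions the total flux gain over all edges is zero, while every edge gains a
nonnegative amount that vanishes only for trivial data. -/
theorem secularDet_hyperbolicMatrix_ne_zero {θ : E → ℝ} (hθ : ∀ e, 0 < θ e) :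
    Γ.secularDet (fun e => hyperbolicMatrix (θ e)) ≠ 0 := by
  classical
  rw [Ne, secularDet_eq_zero_iff]
  rintro ⟨x, hx0, hx⟩
  refine hx0 ?_
  have hend := Γ.eq_of_couplingMap_eq_zero hx
  have hkir := Γ.sum_eq_zero_of_couplingMap_eq_zero hx
  have hiso := fun v => Γ.eq_zero_of_couplingMap_eq_zero hx (v := v)
  simp only [hyperbolicMatrix, Matrix.of_apply, Matrix.cons_val', Matrix.cons_val_zero,
    Matrix.cons_val_one, Matrix.cons_val_fin_one] at hend hkir
  have hflux : ∑ e, ((starRingEnd ℂ) (Complex.cosh (θ e) * x (Sum.inl (Γ.src e)) +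
      Complex.sinh (θ e) * x (Sum.inr e)) *
        (Complex.sinh (θ e) * x (Sum.inl (Γ.src e)) + Complex.cosh (θ e) * x (Sum.inr e)) -
          (starRingEnd ℂ) (x (Sum.inl (Γ.src e))) * x (Sum.inr e)) = 0 := by
    -- The derivative condition at each vertex is weighted by the conjugate vertex value; exchanging
    -- the sums leaves on each edge the flux at its end minus the flux at its start.
    have h1 : ∑ v, (starRingEnd ℂ) (x (Sum.inl v)) * ∑ e, ((if Γ.tgt e = v then
        Complex.sinh (θ e) * x (Sum.inl (Γ.src e)) + Complex.cosh (θ e) * x (Sum.inr e) else 0) -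
          (if Γ.src e = v then x (Sum.inr e) else 0)) = 0 :=
      Finset.sum_eq_zero fun v _ => by rw [hkir v, mul_zero]
    rw [← h1]
    simp only [Finset.mul_sum]
    rw [Finset.sum_comm]
    refine Finset.sum_congr rfl fun e _ => ?_
    simp only [mul_sub, mul_ite, mul_zero, Finset.sum_sub_distrib, Finset.sum_ite_eq,
      Finset.mem_univ, if_true, hend e]
  have hre := congrArg Complex.re hflux
  rw [Complex.re_sum, Complex.zero_re,
    Finset.sum_eq_zero_iff_of_nonneg fun e _ => (energy_flux_nonneg (hθ e) _ _).1] at hre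
  have hzero := fun e => (energy_flux_nonneg (hθ e) _ _).2 (hre e (Finset.mem_univ e))
  funext i
  rcases i with v | e
  · by_cases hv : ∃ e, Γ.src e = v ∨ Γ.tgt e = v
    · obtain ⟨e, rfl | rfl⟩ := hv
      · exact (hzero e).1
      · rw [← hend e, (hzero e).1, (hzero e).2]; simp
    · exact hiso v hv
  · exact (hzero e).2

/-- A circulation around the loop is annihilated by the coupling map. -/
theorem IsLoop.secularDet_eq_zero {Γ : DampedGraph V E} {N : ℕ} {v : Fin (N + 1) → V}
    {e : Fin N → E} (hloop : Γ.IsLoop v e) {τ : E → Matrix (Fin 2) (Fin 2) ℂ}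
    (hτ : ∀ i, τ (e i) = 1) : Γ.secularDet τ = 0 := by
  classical
  -- The sign compares the orientation of the edge with the direction of traversal. If the edge is
  -- itself a loop, both orientations fit and the sign is 1.
  set sgn : Fin N → ℂ := fun i =>
    if Γ.src (e i) = v i.castSucc ∧ Γ.tgt (e i) = v i.succ then 1 else -1 with hsgn
  -- As the loop edges are distinct, at most one summand is nonzero; this is what keeps the
  -- circulation from cancelling.
  set w : E → ℂ := fun f => ∑ i, if e i = f then sgn i else 0 with hw
  refine (Γ.secularDet_eq_zero_iff τ).2 ⟨Sum.elim 0 w, fun h0 => ?_, ?_⟩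
  · have h1 := congrFun h0 (Sum.inr (e ⟨0, hloop.pos⟩))
    simp only [Sum.elim_inr, hw, hloop.injective.eq_iff, Finset.sum_ite_eq', Finset.mem_univ,
      if_true, Pi.zero_apply, hsgn] at h1
    split_ifs at h1 <;> simp at h1
  -- Since `w` lives on the loop, matrix entries matter only there, where they are those of the
  -- identity.
  · have hmul : ∀ (g : E → ℂ) (k : ℂ), (∀ i, g (e i) = k) → ∀ f, g f * w f = k * w f :=
      fun g k hg f => by
        simp only [hw, Finset.mul_sum]
        refine Finset.sum_congr rfl fun i _ => ?_
        split_ifs with hi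
        · rw [← hi, hg]
        · simp
    have h01 := hmul (fun f => τ f 0 1) 0 fun i => by simp [hτ]
    have h11 := hmul (fun f => τ f 1 1) 1 fun i => by simp [hτ]
    funext j
    rcases j with y | f
    · rw [couplingMap_inl]
      simp only [Sum.elim_inl, Sum.elim_inr, Pi.zero_apply, mul_zero, zero_add, ite_self, add_zero,
        h11, one_mul]
      have h2 : ∀ i, (if Γ.tgt (e i) = y then sgn i else 0) - (if Γ.src (e i) = y then sgn i else 0)
          = (if v i.succ = y then 1 else 0) - (if v i.castSucc = y then 1 else 0) := fun i => by
        by_cases h : Γ.src (e i) = v i.castSucc ∧ Γ.tgt (e i) = v i.succ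
        · simp only [hsgn, if_pos h, h.1, h.2]
        · obtain ⟨h3, h4⟩ := (hloop.joins i).resolve_left h
          simp only [hsgn, if_neg h, h3, h4]
          split_ifs <;> simp
      have h3 : ∑ f, ((if Γ.tgt f = y then w f else 0) - (if Γ.src f = y then w f else 0)) =
          ∑ i, ((if Γ.tgt (e i) = y then sgn i else 0) -
            (if Γ.src (e i) = y then sgn i else 0)) := by
        have h4 : ∀ f, (if Γ.tgt f = y then w f else 0) - (if Γ.src f = y then w f else 0) =
            ∑ i, if e i = f then (if Γ.tgt f = y then sgn i else 0) -
              (if Γ.src f = y then sgn i else 0) else 0 := fun f => by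
          simp only [hw]
          split_ifs <;> simp [← Finset.sum_neg_distrib, apply_ite]
        simp only [h4]
        rw [Finset.sum_comm]
        simp
      rw [h3]
      simp only [h2, Finset.sum_sub_distrib]
      -- The contributions at a vertex telescope round the loop because v N = v 0.
      have h5 := Fin.sum_univ_succ fun i => if v i = y then (1 : ℂ) else 0
      rw [Fin.sum_univ_castSucc, hloop.closed] at h5
      linear_combination -h5
    · rw [couplingMap_inr]
      simp [h01]

end DampedGraph

/-! ### Hurwitz's theorem and recurrence -/

/-- A form of Hurwitz's theorem: near a zero of a nonzero limit of holomorphic functions, the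
functions have zeros as well. -/
theorem eventually_exists_eq_zero_of_tendsto {ι : Type*} {l : Filter ι} {F : ι → ℂ → ℂ} {f : ℂ → ℂ}
    {w : ℂ} (hF : ∀ᶠ i in l, ∀ z ∈ Metric.closedBall w 1, DifferentiableAt ℂ (F i) z)
    (hf : Differentiable ℂ f) (hw : f w = 0) (hne : ∃ z, f z ≠ 0)
    (hlim : ∀ z₀, Tendsto (fun q : ι × ℂ => F q.1 q.2) (l ×ˢ 𝓝 z₀) (𝓝 (f z₀)))
    {ε : ℝ} (hε : 0 < ε) : ∀ᶠ i in l, ∃ z, dist z w < ε ∧ F i z = 0 := by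
  have hiso : ∀ᶠ z in 𝓝[≠] w, f z ≠ 0 := by
    by_contra hcon
    have hfr : ∃ᶠ z in 𝓝[≠] w, f z = 0 := by
      simpa only [not_not] using not_eventually.1 hcon
    have han : AnalyticOnNhd ℂ f univ := fun z _ => hf.analyticAt z
    obtain ⟨z, hz⟩ := hne
    exact hz (han.eqOn_zero_of_preconnected_of_frequently_eq_zero isPreconnected_univ (mem_univ w)
      hfr (mem_univ z))
  obtain ⟨δ, hδ, hball⟩ := Metric.eventually_nhds_iff.1 (eventually_nhdsWithin_iff.1 hiso)
  -- Below δ to have no zero of f on the circle, below ε for the conclusion, below 1 to stay where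
  -- `F i` is holomorphic.
  obtain ⟨r, hr0, hr⟩ := exists_between (lt_min hδ (lt_min hε one_pos))
  have hrδ : r < δ := hr.trans_le (min_le_left _ _)
  have hrε : r < ε := hr.trans_le ((min_le_right _ _).trans (min_le_left _ _))
  have hr1 : r < 1 := hr.trans_le ((min_le_right _ _).trans (min_le_right _ _))
  have hsph : ∀ z ∈ Metric.sphere w r, f z ≠ 0 := fun z hz =>
    hball (by rw [Metric.mem_sphere.1 hz]; exact hrδ) fun h => by
      rw [mem_singleton_iff.1 h, Metric.mem_sphere, dist_self] at hz
      exact hr0.ne hz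
  obtain ⟨z₁, hz₁, hmin⟩ := (isCompact_sphere w r).exists_isMinOn
    (NormedSpace.sphere_nonempty.2 hr0.le) hf.continuous.norm.continuousOn
  set m := ‖f z₁‖ with hm
  have hm0 : 0 < m := norm_pos_iff.2 (hsph z₁ hz₁)
  -- Joint convergence at each point of the compact circle yields a uniform lower bound on it.
  have hbig : ∀ᶠ i in l, ∀ z ∈ Metric.sphere w r, m / 2 < ‖F i z‖ := by
    have h1 : {q : ι × ℂ | m / 2 < ‖F q.1 q.2‖} ∈ l ×ˢ 𝓝ˢ (Metric.sphere w r) :=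
      (isCompact_sphere w r).mem_prod_nhdsSet_of_forall fun z hz =>
        (hlim z).norm.eventually_const_lt ((half_lt_self hm0).trans_le (hmin hz))
    exact (Filter.eventually_prod_principal_iff.1
      (Filter.Eventually.filter_mono (Filter.prod_mono_right l principal_le_nhdsSet) h1))
  have hsmall : ∀ᶠ i in l, ‖F i w‖ < m / 2 := by
    have h1 : Tendsto (fun i => F i w) l (𝓝 (f w)) :=
      (hlim w).comp (tendsto_id.prodMk (tendsto_const_nhds))
    rw [hw] at h1
    simpa using h1.norm.eventually_lt_const (by simpa using half_pos hm0)
  filter_upwards [hF, hbig, hsmall] with i h1 h2 h3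
  by_contra! hcon
  have hnz : ∀ z ∈ Metric.closedBall w r, F i z ≠ 0 := fun z hz =>
    hcon z ((Metric.mem_closedBall.1 hz).trans_lt hrε)
  -- Without zeros, 1/F would be holomorphic in the disc and, by the maximum principle, not larger
  -- at the centre than its bound on the circle.
  have hdiff : DiffContOnCl ℂ (fun z => (F i z)⁻¹) (Metric.ball w r) := by
    refine DifferentiableOn.diffContOnCl fun z hz => ?_
    have hz' : z ∈ Metric.closedBall w r := Metric.closure_ball_subset_closedBall hz
    exact ((h1 z (Metric.closedBall_subset_closedBall hr1.le hz')).inv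
      (hnz z hz')).differentiableWithinAt
  have hmax := Complex.norm_le_of_forall_mem_frontier_norm_le Metric.isBounded_ball hdiff
    (C := (m / 2)⁻¹) (fun z hz => by
      rw [frontier_ball w hr0.ne'] at hz
      rw [norm_inv]
      exact inv_anti₀ (half_pos hm0) (h2 z hz).le) (subset_closure (Metric.mem_ball_self hr0))
  rw [norm_inv] at hmax
  have h4 : 0 < ‖F i w‖ := norm_pos_iff.2 (hnz w (Metric.mem_closedBall_self hr0.le))
  exact absurd ((inv_le_inv₀ h4 (half_pos hm0)).1 hmax) (not_le.2 h3)

/-- Simultaneous recurrence of finitely many rotations. -/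
theorem exists_strictMono_tendsto_exp {E : Type*} [Finite E] (l : E → ℝ) :
    ∃ ν : ℕ → ℕ, StrictMono ν ∧ ∀ e, Tendsto
      (fun k => Complex.exp (2 * Real.pi * Complex.I * ν k * l e)) atTop (𝓝 1) := by
  have := Fintype.ofFinite E
  -- In the compact group of tuples of unit complex numbers, the identity is a cluster point of the
  -- powers of any element.
  obtain ⟨ν, hν, h⟩ := MapClusterPt.tendsto_subseq
    (mapClusterPt_one_atTop_pow (fun e => Circle.exp (2 * Real.pi * l e)))
  refine ⟨ν, hν, fun e => ?_⟩
  have hcoe : Continuous fun z : Circle => (z : ℂ) := by fun_prop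
  have h1 := (hcoe.tendsto _).comp (tendsto_pi_nhds.1 h e)
  refine (h1.congr fun k => ?_)
  simp only [Function.comp_apply, Pi.pow_apply, Circle.coe_pow, Circle.coe_exp]
  rw [← Complex.exp_nat_mul]
  congr 1
  push_cast
  ring

theorem add_two_pi_I_mul_ne_zero {z : ℂ} {n : ℕ} (h : ‖z‖ < n) :
    z + 2 * Real.pi * Complex.I * n ≠ 0 := fun h0 => by
  have h1 : ‖z‖ = 2 * Real.pi * n := by
    rw [eq_neg_of_add_eq_zero_left h0]
    simp [abs_of_pos Real.pi_pos]
  nlinarith [Real.pi_gt_three, norm_nonneg z]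

/-! ### Eigenvalues near a zero of the limit determinant, and the conclusion -/

namespace DampedGraph

variable {V E : Type*}

theorem primitive_eq_integral_damping (Γ : DampedGraph V E) {e : E} {c : EdgeCoeff}
    (hc : ∀ᵐ x, x ∈ Icc 0 (Γ.len e) → c.a x = Γ.damping e x ∧ c.b x = Γ.potential e x) :
    c.primitive (Γ.len e) = ((∫ x in (0 : ℝ)..Γ.len e, Γ.damping e x : ℝ) : ℂ) := by
  rw [EdgeCoeff.primitive, intervalIntegral.integral_ofReal]
  congr 1
  refine intervalIntegral.integral_congr_ae ?_
  filter_upwards [hc] with x hx hx'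
  rw [uIoc_of_le (Γ.len_pos e).le] at hx'
  exact (hx ⟨hx'.1.le, hx'.2⟩).1

variable [Fintype V] [Fintype E] (Γ : DampedGraph V E)

/-- If the limit determinant vanishes at `μ₀`, there are eigenvalues of arbitrarily large imaginary
part close to the translates of `μ₀` by multiples of `2 π i`. -/
theorem exists_isEigenvalue {α : E → ℝ}
    (hα : ∀ e, α e = ∫ x in (0 : ℝ)..Γ.len e, Γ.damping e x) {μ₀ : ℂ}
    (h₀ : Γ.secularDet (fun e => hyperbolicMatrix (μ₀ * Γ.len e + α e)) = 0)
    {ε : ℝ} (hε : 0 < ε) (M : ℕ) :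
    ∃ (μ : ℂ) (n : ℕ), M ≤ n ∧ dist μ μ₀ < ε ∧
      Γ.IsEigenvalue (μ + 2 * Real.pi * Complex.I * n) := by
  choose c hc using Γ.exists_edgeCoeff
  have hl := Γ.len_pos
  choose u₁ p₁ h₁ hu₁ hp₁ using fun e => (c e).exists_isEdgeSolution (hl e).le 1 0
  choose v r h₂ hv hr using fun e => (c e).exists_isEdgeSolution (hl e).le 0 1
  obtain ⟨ν, hν, hrec⟩ := exists_strictMono_tendsto_exp Γ.len
  -- The second solution is multiplied by z to have initial derivative z, so that this is the
  -- transfer matrix of (u, u'/z).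
  set T : ℂ → E → Matrix (Fin 2) (Fin 2) ℂ := fun z e =>
    !![u₁ e z (Γ.len e), z * v e z (Γ.len e);
      p₁ e z (Γ.len e) / z, z * r e z (Γ.len e) / z] with hT
  have hTd : ∀ z, z ≠ 0 → ∀ e i j, DifferentiableAt ℂ (fun z => T z e i j) z := by
    intro z hz e i j
    fin_cases i <;> fin_cases j
    · exact hu₁ e z
    · exact differentiableAt_id.mul (hv e z)
    · exact (hp₁ e z).div differentiableAt_id hz
    · exact (differentiableAt_id.mul (hr e z)).div differentiableAt_id hz
  have hsol₂ : ∀ e z, (c e).IsEdgeSolution (Γ.len e) z (fun x => z * v e z x)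
      (fun x => z * r e z x) ∧ z * v e z 0 = 0 ∧ z * r e z 0 = z := fun e z =>
    ⟨(h₂ e z).1.const_mul z, by rw [(h₂ e z).2.1, mul_zero], by rw [(h₂ e z).2.2, mul_one]⟩
  have hev : ∀ᶠ k in atTop, ∃ μ, dist μ μ₀ < ε ∧
      Γ.secularDet (T (μ + 2 * Real.pi * Complex.I * ν k)) = 0 := by
    refine eventually_exists_eq_zero_of_tendsto
      (F := fun k μ => Γ.secularDet (T (μ + 2 * Real.pi * Complex.I * ν k)))
      (f := fun μ => Γ.secularDet (fun e => hyperbolicMatrix (μ * Γ.len e + α e)))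
      ?_ (fun z => ?_) h₀ ?_ (fun z₀ => ?_) hε
    · have h1 : Tendsto (fun k => (ν k : ℝ)) atTop atTop :=
        tendsto_natCast_atTop_atTop.comp hν.tendsto_atTop
      filter_upwards [h1.eventually_gt_atTop (‖μ₀‖ + 1)] with k hk z hz
      have hz0 : z + 2 * Real.pi * Complex.I * ν k ≠ 0 := add_two_pi_I_mul_ne_zero <| by
        have h5 := norm_add_le (z - μ₀) μ₀
        rw [sub_add_cancel, ← dist_eq_norm] at h5
        linarith [Metric.mem_closedBall.1 hz]
      refine Γ.differentiableAt_secularDet fun e i j => ?_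
      exact (hTd _ hz0 e i j).comp (f := fun z => z + 2 * Real.pi * Complex.I * ν k) z
        (differentiableAt_id.add_const _)
    · refine Γ.differentiableAt_secularDet fun e i j => ?_
      exact (differentiable_hyperbolicMatrix_apply i j _).comp
        (f := fun z : ℂ => z * Γ.len e + α e) z
        ((differentiableAt_id.mul_const _).add_const _)
    -- A real μ with μ * len e + α e ≥ len e > 0 on every edge.
    · refine ⟨((∑ e, |α e| / Γ.len e + 1 : ℝ) : ℂ), ?_⟩
      have h1 := Γ.secularDet_hyperbolicMatrix_ne_zero
        (θ := fun e => (∑ f, |α f| / Γ.len f + 1) * Γ.len e + α e) fun e => by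
          have h2 : |α e| / Γ.len e ≤ ∑ f, |α f| / Γ.len f :=
            Finset.single_le_sum (f := fun f => |α f| / Γ.len f)
              (fun f _ => div_nonneg (abs_nonneg _) (hl f).le) (Finset.mem_univ e)
          rw [div_le_iff₀ (hl e)] at h2
          have h3 := neg_abs_le (α e)
          have h4 := hl e
          rw [add_mul]
          linarith
      push_cast at h1 ⊢
      exact h1
    · refine (Γ.continuous_secularDet.tendsto _).comp (tendsto_pi_nhds.2 fun e => ?_)
      -- The edge asymptotics are applied along the product filter, with μ and the index moving
      -- together.
      have hμ : Tendsto (fun q : ℕ × ℂ => q.2) (atTop ×ˢ 𝓝 z₀) (𝓝 z₀) := tendsto_snd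
      have hn : Tendsto (fun q : ℕ × ℂ => ν q.1) (atTop ×ˢ 𝓝 z₀) atTop :=
        hν.tendsto_atTop.comp tendsto_fst
      have hrec' : Tendsto (fun q : ℕ × ℂ =>
          Complex.exp (2 * Real.pi * Complex.I * ν q.1 * Γ.len e)) (atTop ×ˢ 𝓝 z₀) (𝓝 1) :=
        (hrec e).comp tendsto_fst
      obtain ⟨t1, t2⟩ := EdgeCoeff.tendsto_edgeSolution (c := c e) (u₀ := 1) (w₀ := 0) (hl e).le hμ
        hn hrec' (fun q => (h₁ e _).1) (fun q => (h₁ e _).2.1) (fun q => by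
          rw [(h₁ e _).2.2, mul_zero])
      obtain ⟨t3, t4⟩ := EdgeCoeff.tendsto_edgeSolution (c := c e) (u₀ := 0) (w₀ := 1) (hl e).le hμ
        hn hrec' (fun q => (hsol₂ e _).1) (fun q => (hsol₂ e _).2.1) (fun q => by
          rw [(hsol₂ e _).2.2, mul_one])
      rw [Γ.primitive_eq_integral_damping (hc e), ← hα] at t1 t2 t3 t4
      simp only [mul_one, mul_zero, add_zero, zero_add] at t1 t2 t3 t4
      refine tendsto_pi_nhds.2 fun i => tendsto_pi_nhds.2 fun j => ?_
      fin_cases i <;> fin_cases j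
      · exact t1
      · exact t3
      · exact t2
      · exact t4
  have hz : ∀ᶠ k in atTop, ‖μ₀‖ + ε < ν k :=
    (tendsto_natCast_atTop_atTop.comp hν.tendsto_atTop).eventually_gt_atTop _
  obtain ⟨k, ⟨μ, hμ, hdet⟩, hk, hM⟩ :=
    (hev.and (hz.and (hν.tendsto_atTop.eventually_ge_atTop M))).exists
  have hz0 : μ + 2 * Real.pi * Complex.I * ν k ≠ 0 := add_two_pi_I_mul_ne_zero <| by
    have h5 := norm_add_le (μ - μ₀) μ₀
    rw [sub_add_cancel, ← dist_eq_norm] at h5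
    linarith
  exact ⟨μ, ν k, hM, hμ, Γ.isEigenvalue_of_secularDet_eq_zero hc hz0 (fun e => h₁ e _)
    (fun e => hsol₂ e _) hdet⟩

end DampedGraph

end

theorem mainTheorem3 {V E : Type*} [Finite V] [Fintype E] (Γ : DampedGraph V E)
    (N : ℕ) (v : Fin (N + 1) → V) (e : Fin N → E) (hloop : Γ.IsLoop v e)
    (hlen : ∀ i, Γ.len (e i) = 1)
    (a : ℝ) (havg : ∀ i, Γ.avgDamping (e i) = a) :
    Γ.IsHighFrequencyAbscissa (-a) := by
  have := Fintype.ofFinite V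
  have h₀ : Γ.secularDet (fun f => hyperbolicMatrix (((-a : ℝ) : ℂ) * Γ.len f +
      ((∫ x in (0 : ℝ)..Γ.len f, Γ.damping f x : ℝ) : ℂ))) = 0 := by
    refine hloop.secularDet_eq_zero fun i => ?_
    have h1 : ∫ x in (0 : ℝ)..Γ.len (e i), Γ.damping (e i) x = a := by
      rw [← havg i, DampedGraph.avgDamping, hlen, div_one]
    -- On a loop edge the angle is -a · 1 + a = 0; here unit length and the common average enter.
    rw [h1, hlen, ← hyperbolicMatrix_zero]
    congr 1
    push_cast
    ring
  have hex : ∀ m : ℕ, ∃ z : ℂ, Γ.IsEigenvalue z ∧ (m : ℝ) ≤ z.im ∧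
      |z.re - -a| ≤ 1 / ((m : ℝ) + 1) := fun m => by
    -- With n ≥ m + 1 and |Im μ| ≤ 1, the imaginary part is at least 2πn - 1 ≥ m.
    obtain ⟨μ, n, hn, hμ, hz⟩ := Γ.exists_isEigenvalue (fun _ => rfl) h₀
      (Nat.one_div_pos_of_nat (α := ℝ) (n := m)) (m + 1)
    rw [dist_eq_norm] at hμ
    have hre := (Complex.abs_re_le_norm _).trans hμ.le
    have him := (Complex.abs_im_le_norm _).trans hμ.le
    simp only [Complex.sub_re, Complex.sub_im, Complex.ofReal_re, Complex.ofReal_im,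
      sub_zero] at hre him
    refine ⟨_, hz, ?_, by simpa using hre⟩
    have h1 : (1 : ℝ) / (m + 1) ≤ 1 := by
      rw [div_le_one (by positivity)]
      linarith [Nat.cast_nonneg (α := ℝ) m]
    have h2 : ((m : ℝ) + 1) ≤ n := by exact_mod_cast hn
    have h3 := Real.pi_gt_three
    have h4 := neg_abs_le μ.im
    have h5 : (μ + 2 * Real.pi * Complex.I * n).im = μ.im + 2 * Real.pi * n := by simp
    rw [h5]
    nlinarith [Nat.cast_nonneg (α := ℝ) m]
  choose z hz him hre using hex
  refine ⟨z, hz, Or.inl (tendsto_atTop_mono him tendsto_natCast_atTop_atTop), ?_⟩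
  rw [tendsto_iff_dist_tendsto_zero]
  exact squeeze_zero (fun _ => dist_nonneg) hre tendsto_one_div_add_atTop_nhds_zero_nat
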